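/- Let $(w_k)_{k\ge0}$ be nonnegative real weights with $w_0>0$ and $w_{k+1}/w_k\to a$ as $k\to\infty$, where $0<a<\infty$. Let $\Phi(t)=\sum_{k\ge0}w_kt^k$, with radius of convergence $\rho$, let $\Psi(t)=t\Phi'(t)/\Phi(t)=\sum_k kw_kt^k/\sum_k w_kt^k$ for $0\le t\le\rho$ with $\Phi(t)<\infty$, let $\Psi(\rho)=\lim_{t\uparrow\rho}\Psi(t)$ if $\Phi(\rho)=\infty$, and let $\nu=\Psi(\rho)\in(0,\infty]$. For integers $m\ge0$, $n\ge1$ with $Z(m,n)=\sum_{y\in\mathbb N_0^n,\ \sum y_i=m}\prod_{i}w_{y_i}>0$, let $(Y_1,\dots,Y_n)$ be the random allocation of $m$ balls in $n$ boxes taking the value $y\in\mathbb N_0^n$, $\sum_i y_i=m$, with probability $\prod_i w_{y_i}/Z(m,n)$, and let $Y_{(1)}=\max_iY_i$. Suppose that $n\to\infty$ (through all positive integers) and $m=m(n)=\lambda n+o(\sqrt n)$ with $0<\lambda<\nu$. Then $Z(m,n)>0$ for all large $n$. Let $\tau$ be the unique number in $[0,\rho]$ with $\Psi(\tau)=\lambda$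 (it exists), let $\pi_k=w_k\tau^k/\Phi(\tau)$ and $q=\tau a=\tau/\rho$; then $0<q<1$. Let $k(n)\ge0$ be any integers with $\pi_{k(n)}=\Theta(1/n)$; equivalently, $k(n)=k_1(n)+O(1)$, where $k_1(n)=\max\{k:\pi_k\ge1/n\}$. Let $N=N(n)$ be any nonnegative integers with $$N\sim\frac{n\,\pi_{k(n)}q^{-k(n)}}{1-q}=\frac{n\,w_{k(n)}a^{-k(n)}}{\Phi(\tau)(1-q)}.$$ Let $W$ have the Gumbel distribution, $\mathbb P(W\le x)=e^{-e^{-x}}$ for $x\in\mathbb R$, and write $X_n\approx X_n'$ if the total variation distance of the laws of $X_n$ and $X'_n$ tends to $0$. Then the following hold. (i) $Y_{(1)}\approx\max_{i\le N}\eta_i$, where $\eta_1,\dots,\eta_N$ are i.i.d. geometric $\mathrm{Ge}(1-q)$, that is, $\mathbb P(\eta_i=k)=(1-q)q^k$ for $k\ge0$. (ii) $Y_{(1)}\approx\lfloor W/\log(1/q)+\log_{1/q}N\rfloor$. (iii) Let $b_n=n\pi_{k(n)}$; then $b_n=\Theta(1)$ and $Y_{(1)}-k(n)\approx\lfloor (W+\log(b_n/(1-q)))/\log(1/q)\rfloor$.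 The sequence $Y_{(1)}-k(n)$ is tight, and along every subsequence for which $b_n$ converges to some $b$ it converges in distribution, to $\lfloor (W+\log(b/(1-q)))/\log(1/q)\rfloor$. Nevertheless $Y_{(1)}-k(n)$ has no limit distribution as $n\to\infty$. -/

import Mathlib

open Filter Topology MeasureTheory ProbabilityTheory Asymptotics
open scoped ENNReal NNReal

noncomputable section

namespace BallsInBoxes

/-- The generating function `Φ(t) = ∑ w_k t^k` of the weights, for `t ∈ [0, ∞]`. -/
def genFun (w : ℕ → ℝ≥0) (t : ℝ≥0∞) : ℝ≥0∞ := ∑' k : ℕ, (w k : ℝ≥0∞) * t ^ k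

/-- The radius of convergence `ρ ∈ [0, ∞]` of `Φ`. -/
def rho (w : ℕ → ℝ≥0) : ℝ≥0∞ :=
  (FormalMultilinearSeries.ofScalars ℝ (fun k => (w k : ℝ))).radius

/-- The quotient `∑ k w_k t^k / ∑ w_k t^k`. -/
def psiQuot (w : ℕ → ℝ≥0) (t : ℝ≥0∞) : ℝ≥0∞ :=
  (∑' k : ℕ, (k : ℝ≥0∞) * ((w k : ℝ≥0∞) * t ^ k)) / genFun w t

/-- `Ψ(t) = t Φ'(t) / Φ(t)` where `Φ(t) < ∞`. If `Φ(t) = ∞`, the limit from the left is taken;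
this is used only for `t ≤ ρ`, hence only at `t = ρ`. -/
def psi (w : ℕ → ℝ≥0) (t : ℝ≥0∞) : ℝ≥0∞ :=
  open Classical in
  if genFun w t < ∞ then psiQuot w t else limUnder (𝓝[<] t) (psiQuot w)

/-- `ν = Ψ(ρ)`. -/
def nu (w : ℕ → ℝ≥0) : ℝ≥0∞ := psi w (rho w)

/-- `π_k = w_k τ^k / Φ(τ)`. -/
def boxProb (w : ℕ → ℝ≥0) (τ : ℝ≥0) (k : ℕ) : ℝ :=
  (w k : ℝ) * (τ : ℝ) ^ k / (genFun w τ).toReal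

/-- `k₁(n) = max {k : π_k ≥ 1/n}`. -/
def kOne (w : ℕ → ℝ≥0) (τ : ℝ≥0) (n : ℕ) : ℕ :=
  sSup {k : ℕ | 1 / (n : ℝ) ≤ boxProb w τ k}

/-- The set of allocations of `m` balls in `n` boxes: all `y ∈ ℕ^n` with `∑ y_i = m`. -/
def allocations (m n : ℕ) : Finset (Fin n → ℕ) := Finset.piAntidiag Finset.univ m

/-- The weight `w(y) = ∏ w_{y_i}` of an allocation. -/
def weight (w : ℕ → ℝ≥0) {n : ℕ} (y : Fin n → ℕ) : ℝ≥0 := ∏ i, w (y i)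

/-- The partition function `Z(m,n)`. -/
def partitionFun (w : ℕ → ℝ≥0) (m n : ℕ) : ℝ≥0 := ∑ y ∈ allocations m n, weight w y

/-- The random allocation `B_{m,n}`: allocations have probability `w(y) / Z(m,n)`.
In the excluded case `Z(m,n) = 0` the value is a placeholder. -/
def randomAllocation (w : ℕ → ℝ≥0) (m n : ℕ) : PMF (Fin n → ℕ) :=
  open Classical in
  if h : partitionFun w m n = 0 then PMF.pure 0
  else PMF.ofFinset
    (fun y => if y ∈ allocations m n then ((weight w y / partitionFun w m n : ℝ≥0) : ℝ≥0∞) else 0)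
    (allocations m n)
    (by
      rw [Finset.sum_congr rfl (fun y hy => if_pos hy), ← ENNReal.ofNNReal_finsetSum,
        ← Finset.sum_div]
      change (((partitionFun w m n) / (partitionFun w m n) : ℝ≥0) : ℝ≥0∞) = 1
      rw [div_self h, ENNReal.coe_one])
    (fun _ hy => if_neg hy)

/-- The law of the maximal occupancy `Y_(1) = max_i Y_i`, as a distribution on `ℤ`. -/
def maxOccupancy (w : ℕ → ℝ≥0) (m n : ℕ) : PMF ℤ :=
  (randomAllocation w m n).map (fun y => ((Finset.univ.sup y : ℕ) : ℤ))

/-- A distribution on `ℤ` as a point of the space of probability measures (weak topology). -/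
def toProb (p : PMF ℤ) : ProbabilityMeasure ℤ := ⟨p.toMeasure, inferInstance⟩

/-- The law of `max_{i ≤ N} η_i`, for `η_1, …, η_N` i.i.d. `Ge(p)`,
that is, `P(η_i = k) = p (1 - p)^k` for `k ≥ 0`. -/
def maxGeometric (p : unitInterval) (N : ℕ) : Measure ℤ :=
  (Measure.pi (fun _ : Fin N => geometricMeasure p)).map
    (fun x => ((Finset.univ.sup x : ℕ) : ℤ))

/-- The Gumbel distribution function `x ↦ exp (-exp (-x))`. -/
def gumbelCDF : StieltjesFunction ℝ where
  toFun x := Real.exp (-Real.exp (-x))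
  mono' x y h := by
    dsimp only
    gcongr
  right_continuous' x := by
    apply Continuous.continuousWithinAt
    fun_prop

/-- The Gumbel distribution. -/
def gumbel : Measure ℝ := gumbelCDF.measure

theorem tendsto_gumbelCDF_atBot : Tendsto gumbelCDF atBot (𝓝 0) :=
  Real.tendsto_exp_atBot.comp
    (tendsto_neg_atTop_atBot.comp (Real.tendsto_exp_atTop.comp tendsto_neg_atBot_atTop))

theorem tendsto_gumbelCDF_atTop : Tendsto gumbelCDF atTop (𝓝 1) := by
  have h : Tendsto (fun x : ℝ => -Real.exp (-x)) atTop (𝓝 0) := by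
    simpa using (Real.tendsto_exp_atBot.comp tendsto_neg_atTop_atBot).neg
  have h2 := (Real.continuous_exp.tendsto 0).comp h
  rw [Real.exp_zero] at h2
  exact h2

instance : IsProbabilityMeasure gumbel :=
  gumbelCDF.isProbabilityMeasure tendsto_gumbelCDF_atBot tendsto_gumbelCDF_atTop

theorem gumbel_Iic (x : ℝ) :
    gumbel (Set.Iic x) = ENNReal.ofReal (Real.exp (-Real.exp (-x))) := by
  rw [gumbel, gumbelCDF.measure_Iic tendsto_gumbelCDF_atBot, sub_zero]
  rfl

/-- The total variation distance `sup_A |μ(A) - μ'(A)|` of two finite measures. -/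
def tvDist {α : Type*} [MeasurableSpace α] (μ μ' : Measure α) : ℝ :=
  ⨆ A : {A : Set α // MeasurableSet A}, |μ.real A - μ'.real A|

/-- `X_n ≈ X'_n` in distribution, for sequences of random variables with laws `μ n` and `μ' n`:
the total variation distance tends to `0`. -/
def DApprox {α : Type*} [MeasurableSpace α] (μ μ' : ℕ → Measure α) : Prop :=
  Tendsto (fun n => tvDist (μ n) (μ' n)) atTop (𝓝 0)

end BallsInBoxes

end

/-!
Tilting the weights to `π_k = w_k τ ^ k / Φ(τ)`, a probability distribution with mean `λ`, does not
change the random allocation, so that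
`P(Y_(1) ≤ K) = P(S_n = m, all ξ_i ≤ K) / P(S_n = m)`, where `S_n = ξ_1 + ⋯ + ξ_n` and the `ξ_i` are
independent with distribution `π`. By Fourier inversion and dominated convergence, `P(S_n = m)` is
asymptotic to `1 / √(2π n σ²)`, where `σ²` is the variance of `π`, and, as long as `n P(ξ > K)`
stays bounded, truncation at `K` multiplies this by `exp (-n P(ξ > K))`. The tail of `π` is
asymptotically geometric with ratio `q`, hence `P(Y_(1) ≤ k(n) + j)` is close to
`exp (-n π_{k(n)} q ^ (j + 1) / (1 - q))` for every integer `j`. All comparison laws have the same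
asymptotic distribution functions, and for laws on `ℤ` with these distribution functions closeness
of the distribution functions gives closeness in total variation. A limit law of `Y_(1) - k(n)`
would force `n π_{k(n)}` to converge; then `π_{k(n+1)} / π_{k(n)} → 1`, so that `k(n)` is eventually
constant, which is absurd.
-/

namespace BallsInBoxes

/-! ### Exponential asymptotics -/

theorem norm_exp_I_mul_sub_one_sub_le (t : ℝ) :
    ‖Complex.exp (Complex.I * t) - 1 - Complex.I * t‖ ≤ 2 * t ^ 2 := by
  have norm_I_mul : ‖Complex.I * (t : ℂ)‖ = |t| := by simp
  rcases le_or_gt |t| 1 with h | h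
  · refine (Complex.norm_exp_sub_one_sub_id_le (norm_I_mul.trans_le h)).trans ?_
    rw [norm_I_mul, sq_abs]
    nlinarith [sq_nonneg t]
  · have exp_sub_one_le := Real.norm_exp_I_mul_ofReal_sub_one_le (x := t)
    have triangle := norm_sub_le (Complex.exp (Complex.I * t) - 1) (Complex.I * t)
    rw [norm_I_mul] at triangle
    rw [Real.norm_eq_abs] at exp_sub_one_le
    nlinarith [sq_abs t]

theorem tendsto_natCast_mul_of_isLittleO_pow {f : ℂ → ℂ} {z : ℕ → ℂ} {j : ℕ}
    (hf : f =o[𝓝 0] (· ^ j)) (hz : Tendsto z atTop (𝓝 0))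
    (hbdd : (fun n => n * z n ^ j) =O[atTop] fun _ => (1 : ℝ)) :
    Tendsto (fun n : ℕ => n * f (z n)) atTop (𝓝 0) := by
  have := (isBigO_refl (fun n : ℕ => (n : ℂ)) atTop).mul_isLittleO (hf.comp_tendsto hz)
  exact (isLittleO_one_iff ℝ).1 (this.trans_isBigO hbdd)

theorem tendsto_mul_exp_div_sqrt_sub_one_sub (y : ℂ) :
    Tendsto (fun n : ℕ => (n : ℂ) * (Complex.exp (y / (√n : ℝ)) - 1 - y / (√n : ℝ)))
      atTop (𝓝 (y ^ 2 / 2)) := by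
  have div_tendsto : Tendsto (fun n : ℕ => y / (√n : ℝ)) atTop (𝓝 0) := by
    rw [tendsto_zero_iff_norm_tendsto_zero]
    simpa [abs_of_nonneg] using (tendsto_const_nhds (x := ‖y‖)).div_atTop
      (Real.tendsto_sqrt_atTop.comp tendsto_natCast_atTop_atTop)
  have mul_sq : (fun n : ℕ => (n : ℂ) * (y / (√n : ℝ)) ^ 2) =ᶠ[atTop] fun _ => y ^ 2 := by
    filter_upwards [eventually_gt_atTop 0] with n hn
    have : (n : ℂ) ≠ 0 := mod_cast hn.ne'
    rw [div_pow, ← Complex.ofReal_pow, Real.sq_sqrt n.cast_nonneg, Complex.ofReal_natCast,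
      mul_div_cancel₀ _ this]
  have remainder := tendsto_natCast_mul_of_isLittleO_pow
    (Complex.exp_sub_sum_range_succ_isLittleO_pow 2) div_tendsto
    (mul_sq.trans_isBigO (isBigO_const_const _ one_ne_zero _))
  have := remainder.add_const (y ^ 2 / 2)
  rw [zero_add] at this
  refine this.congr' (mul_sq.mono fun n hn => ?_)
  simp only [Finset.sum_range_succ, Finset.sum_range_zero, Nat.factorial]
  push_cast
  linear_combination (-1 / 2) * hn

theorem tendsto_mul_exp_div_sub_one_sub {c : ℕ → ℂ} (hc : c =O[atTop] fun _ => (1 : ℝ))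
    (hdiv : Tendsto (fun n => c n / n) atTop (𝓝 0)) :
    Tendsto (fun n : ℕ => n * (Complex.exp (c n / n) - 1 - c n / n * Complex.exp (c n / n)))
      atTop (𝓝 0) := by
  refine tendsto_natCast_mul_of_isLittleO_pow (j := 1)
    (f := fun s => Complex.exp s - 1 - s * Complex.exp s) ?_ hdiv ?_
  · have deriv_zero :
        HasDerivAt (fun s : ℂ => Complex.exp s - s * Complex.exp s) 0 0 := by
      convert! (Complex.hasDerivAt_exp 0).sub ((hasDerivAt_id 0).mul (Complex.hasDerivAt_exp 0))
        using 1
      simp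
    simpa [sub_right_comm] using hasDerivAt_iff_isLittleO_nhds_zero.1 deriv_zero
  · refine EventuallyEq.trans_isBigO ?_ hc
    filter_upwards [eventually_gt_atTop 0] with n hn
    rw [pow_one, mul_div_cancel₀ _ (mod_cast hn.ne')]

-- With `s = c / n`, the error splits as
-- `n * (z * exp s - 1) = (n * (z - 1) + c) * exp s + n * (exp s - 1 - s * exp s)`.
theorem tendsto_pow_mul_exp {z c : ℕ → ℂ} {L : ℂ} (hc : c =O[atTop] fun _ => (1 : ℝ))
    (h : Tendsto (fun n => n * (z n - 1) + c n) atTop (𝓝 L)) :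
    Tendsto (fun n => z n ^ n * Complex.exp (c n)) atTop (𝓝 (Complex.exp L)) := by
  have div_tendsto : Tendsto (fun n => c n / n) atTop (𝓝 0) := by
    simpa only [div_eq_inv_mul] using
      (tendsto_inv_atTop_nhds_zero_nat (𝕜 := ℂ)).zero_mul_isBoundedUnder_le hc.isBoundedUnder_le
  have exp_tendsto : Tendsto (fun n => Complex.exp (c n / n)) atTop (𝓝 1) := by
    simpa [Function.comp_def] using (Complex.continuous_exp.tendsto 0).comp div_tendsto
  have mul_sub_one : Tendsto (fun n => n * (z n * Complex.exp (c n / n) - 1)) atTop (𝓝 L) := by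
    have := (h.mul exp_tendsto).add (tendsto_mul_exp_div_sub_one_sub hc div_tendsto)
    rw [mul_one, add_zero] at this
    refine this.congr' ?_
    filter_upwards [eventually_gt_atTop 0] with n hn
    have : (n : ℂ) ≠ 0 := mod_cast hn.ne'
    field_simp
    ring
  refine (Complex.tendsto_one_add_pow_exp_of_tendsto mul_sub_one).congr' ?_
  filter_upwards [eventually_gt_atTop 0] with n hn
  rw [add_sub_cancel, mul_pow, ← Complex.exp_nat_mul, mul_div_cancel₀ _ (mod_cast hn.ne')]

theorem norm_tsum_mul_exp_I_sub_one_le {ι : Type*} {p d : ι → ℝ} (hp : ∀ i, 0 ≤ p i)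
    (hps : Summable p) (hd : Summable fun i => p i * d i ^ 2) :
    ‖∑' i, (p i : ℂ) * (Complex.exp (Complex.I * d i) - 1)‖ ≤
      √(∑' i, p i) * √(∑' i, p i * d i ^ 2) := by
  have sq_rpow {u : ℝ} (hu : 0 ≤ u) : √u ^ (2 : ℝ) = u := by
    rw [Real.rpow_two, Real.sq_sqrt hu]
  have hpd (i : ι) : 0 ≤ p i * d i ^ 2 := mul_nonneg (hp i) (sq_nonneg _)
  obtain ⟨S, -, hS, cauchy_schwarz⟩ := Real.inner_le_Lp_mul_Lq_hasSum_of_nonneg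
    (f := fun i => √(p i)) (g := fun i => √(p i * d i ^ 2)) Real.HolderConjugate.two_two
    (Real.sqrt_nonneg (∑' i, p i)) (Real.sqrt_nonneg (∑' i, p i * d i ^ 2))
    (fun _ => Real.sqrt_nonneg _) (fun _ => Real.sqrt_nonneg _)
    (by simpa only [sq_rpow (hp _), sq_rpow (tsum_nonneg hp)] using hps.hasSum)
    (by simpa only [sq_rpow (hpd _), sq_rpow (tsum_nonneg hpd)] using hd.hasSum)
  refine (tsum_of_norm_bounded cauchy_schwarz fun i => ?_).trans hS
  rw [Real.sqrt_mul (hp i), Real.sqrt_sq_eq_abs, ← mul_assoc, Real.mul_self_sqrt (hp i), norm_mul,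
    Complex.norm_of_nonneg (hp i)]
  exact mul_le_mul_of_nonneg_left Real.norm_exp_I_mul_ofReal_sub_one_le (hp i)

/-! ### Fourier inversion for truncated sums -/

/-- The generating polynomial `∑_{k ≤ K} p_k z^k` of the truncated sequence at `z = e^{iθ}`:
the characteristic function of the restriction of `p` to `{0, …, K}`. -/
noncomputable def truncChar (p : ℕ → ℝ) (K : ℕ) (θ : ℝ) : ℂ :=
  ∑ k ∈ Finset.range (K + 1), (p k : ℂ) * Complex.exp (Complex.I * ((k * θ : ℝ) : ℂ))

/-- The total weight `∑_y ∏_i p_{y_i}` of the allocations `y` of `m` balls in `n` boxes with at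
most `K` balls in each box. For a probability distribution `p` it is the probability that `n`
independent variables with law `p` are all at most `K` and have sum `m`. -/
noncomputable def truncPartition (p : ℕ → ℝ) (K m n : ℕ) : ℝ :=
  ∑ y ∈ (allocations m n).filter (fun y => ∀ i, y i ≤ K), ∏ i, p (y i)

@[fun_prop]
theorem continuous_truncChar (p : ℕ → ℝ) (K : ℕ) : Continuous (truncChar p K) := by
  unfold truncChar
  fun_prop

theorem integral_exp_I_mul_int_mul (j : ℤ) :
    ∫ θ in (-Real.pi)..Real.pi, Complex.exp (Complex.I * ((j * θ : ℝ) : ℂ)) =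
      if j = 0 then 2 * (Real.pi : ℂ) else 0 := by
  split_ifs with hj
  · simp only [hj, Int.cast_zero, zero_mul, Complex.ofReal_zero, mul_zero, Complex.exp_zero,
      intervalIntegral.integral_const, Complex.real_smul]
    push_cast
    ring
  · have ne_zero : Complex.I * (j : ℂ) ≠ 0 := mul_ne_zero Complex.I_ne_zero (mod_cast hj)
    simp only [Complex.ofReal_mul, Complex.ofReal_intCast, ← mul_assoc]
    rw [integral_exp_mul_complex ne_zero, div_eq_zero_iff, sub_eq_zero,
      Complex.exp_eq_exp_iff_exists_int]
    exact Or.inl ⟨j, by push_cast; ring⟩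

theorem truncChar_pow_mul_exp (p : ℕ → ℝ) (K m n : ℕ) (θ : ℝ) :
    truncChar p K θ ^ n * Complex.exp (-(Complex.I * ((m * θ : ℝ) : ℂ))) =
      ∑ y ∈ Fintype.piFinset (fun _ : Fin n => Finset.range (K + 1)), ((∏ i, p (y i) : ℝ) : ℂ) *
        Complex.exp (Complex.I * ((((∑ i, y i : ℕ) : ℤ) - (m : ℤ) : ℤ) * θ : ℝ)) := by
  have pow_eq_prod : truncChar p K θ ^ n = ∏ _i : Fin n, truncChar p K θ := by simp
  rw [pow_eq_prod]
  simp only [truncChar]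
  rw [Finset.prod_univ_sum, Finset.sum_mul]
  refine Finset.sum_congr rfl fun y _ => ?_
  rw [Finset.prod_mul_distrib, ← Complex.exp_sum, mul_assoc, ← Complex.exp_add,
    ← Finset.mul_sum]
  push_cast
  rw [← Finset.sum_mul]
  ring_nf

theorem filter_sum_eq_piFinset_range (K m n : ℕ) :
    {y ∈ Fintype.piFinset fun _ : Fin n => Finset.range (K + 1) | ∑ i, y i = m} =
      {y ∈ allocations m n | ∀ i, y i ≤ K} := by
  ext y
  simp [allocations, and_comm]

theorem truncPartition_eq_integral (p : ℕ → ℝ) (K m n : ℕ) :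
    ((2 * Real.pi * truncPartition p K m n : ℝ) : ℂ) = ∫ θ in (-Real.pi)..Real.pi,
      truncChar p K θ ^ n * Complex.exp (-(Complex.I * ((m * θ : ℝ) : ℂ))) := by
  simp_rw [truncChar_pow_mul_exp]
  rw [intervalIntegral.integral_finsetSum
    fun y _ => Continuous.intervalIntegrable (by fun_prop) _ _]
  simp_rw [intervalIntegral.integral_const_mul, integral_exp_I_mul_int_mul, sub_eq_zero,
    Nat.cast_inj, mul_ite, mul_zero]
  rw [← Finset.sum_filter, filter_sum_eq_piFinset_range, truncPartition, ← Finset.sum_mul]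
  push_cast
  ring

theorem norm_add_mul_exp_I_le {α β : ℝ} (hα : 0 < α) (hβ : 0 < β) (θ : ℝ) :
    ‖(α : ℂ) + β * Complex.exp (Complex.I * θ)‖ ≤
      α + β - α * β / (α + β) * (1 - Real.cos θ) := by
  have cos_le_one := Real.cos_le_one θ
  have rhs_nonneg : 0 ≤ α + β - α * β / (α + β) * (1 - Real.cos θ) := by
    have harmonic_le : α * β / (α + β) * 2 ≤ α + β := by
      rw [div_mul_eq_mul_div, div_le_iff₀ (by positivity)]
      nlinarith [sq_nonneg (α - β), mul_pos hα hβ]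
    have : α * β / (α + β) * (1 - Real.cos θ) ≤ α * β / (α + β) * 2 := by
      gcongr
      linarith [Real.neg_one_le_cos θ]
    linarith
  have normSq_eq : Complex.normSq ((α : ℂ) + β * Complex.exp (Complex.I * θ)) =
      (α + β) ^ 2 - 2 * (α * β) * (1 - Real.cos θ) := by
    rw [mul_comm Complex.I, Complex.exp_mul_I, Complex.normSq_apply]
    simp only [← Complex.ofReal_cos, ← Complex.ofReal_sin, Complex.add_re, Complex.add_im,
      Complex.mul_re, Complex.mul_im, Complex.ofReal_re, Complex.ofReal_im, Complex.I_re,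
      Complex.I_im]
    linear_combination β ^ 2 * Real.sin_sq_add_cos_sq θ
  rw [← sq_le_sq₀ (norm_nonneg _) rhs_nonneg, ← Complex.normSq_eq_norm_sq, normSq_eq]
  have harmonic_mul : (α + β) * (α * β / (α + β)) = α * β := by field_simp
  nlinarith [sq_nonneg (α * β / (α + β) * (1 - Real.cos θ))]

theorem norm_truncChar_le {p : ℕ → ℝ} (hp : ∀ k, 0 ≤ p k) {l K : ℕ} (hl : 0 < p l)
    (hl' : 0 < p (l + 1)) (hK : l + 1 ≤ K) (θ : ℝ) :
    ‖truncChar p K θ‖ ≤ ∑ k ∈ Finset.range (K + 1), p k -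
      p l * p (l + 1) / (p l + p (l + 1)) * (1 - Real.cos θ) := by
  have pair_subset : {l, l + 1} ⊆ Finset.range (K + 1) := by grind
  have exp_succ : Complex.exp (Complex.I * (((l + 1 : ℕ) * θ : ℝ) : ℂ)) =
      Complex.exp (Complex.I * ((l * θ : ℝ) : ℂ)) * Complex.exp (Complex.I * θ) := by
    rw [← Complex.exp_add]
    push_cast
    ring_nf
  have pair_le : ‖(p l : ℂ) * Complex.exp (Complex.I * ((l * θ : ℝ) : ℂ)) +
      (p (l + 1) : ℂ) * Complex.exp (Complex.I * (((l + 1 : ℕ) * θ : ℝ) : ℂ))‖ ≤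
      p l + p (l + 1) - p l * p (l + 1) / (p l + p (l + 1)) * (1 - Real.cos θ) := by
    rw [exp_succ, mul_left_comm, mul_comm (p l : ℂ), ← mul_add, norm_mul,
      Complex.norm_exp_I_mul_ofReal, one_mul]
    exact norm_add_mul_exp_I_le hl hl' θ
  have rest_le : ‖∑ k ∈ Finset.range (K + 1) \ {l, l + 1},
      (p k : ℂ) * Complex.exp (Complex.I * ((k * θ : ℝ) : ℂ))‖ ≤
      ∑ k ∈ Finset.range (K + 1) \ {l, l + 1}, p k := by
    refine norm_sum_le_of_le _ fun k _ => ?_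
    rw [norm_mul, Complex.norm_exp_I_mul_ofReal, mul_one, Complex.norm_of_nonneg (hp k)]
  rw [truncChar, ← Finset.sum_sdiff pair_subset, ← Finset.sum_sdiff pair_subset,
    Finset.sum_pair l.succ_ne_self.symm, Finset.sum_pair l.succ_ne_self.symm, add_sub_assoc]
  exact (norm_add_le _ _).trans (add_le_add rest_le pair_le)

theorem exists_norm_truncChar_le_exp {p : ℕ → ℝ} (hp : ∀ k, 0 ≤ p k) (hs : HasSum p 1) {l : ℕ}
    (hl : 0 < p l) (hl' : 0 < p (l + 1)) :
    ∃ c > 0, ∀ K ≥ l + 1, ∀ θ : ℝ, |θ| ≤ Real.pi →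
      ‖truncChar p K θ‖ ≤ Real.exp (-(c * θ ^ 2)) := by
  refine ⟨p l * p (l + 1) / (p l + p (l + 1)) * (2 / Real.pi ^ 2), by positivity,
    fun K hK θ hθ => ?_⟩
  set d := p l * p (l + 1) / (p l + p (l + 1))
  have : 0 ≤ d := by positivity
  calc ‖truncChar p K θ‖ ≤ ∑ k ∈ Finset.range (K + 1), p k - d * (1 - Real.cos θ) :=
        norm_truncChar_le hp hl hl' hK θ
    _ ≤ 1 - d * (2 / Real.pi ^ 2 * θ ^ 2) := by
        gcongr
        · exact sum_le_hasSum _ (fun k _ => hp k) hs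
        · linarith [Real.cos_le_one_sub_mul_cos_sq hθ]
    _ ≤ Real.exp (-(d * (2 / Real.pi ^ 2) * θ ^ 2)) := by
        linarith [Real.add_one_le_exp (-(d * (2 / Real.pi ^ 2) * θ ^ 2))]

/-! ### The local limit theorem for truncated sums -/

/-- A probability distribution `p` on `ℕ` with mean `lam` and finite variance that charges two
consecutive integers. The last condition makes the span `1`, which is what the local limit theorem
needs. -/
structure LatticeLaw (p : ℕ → ℝ) (lam : ℝ) : Prop where
  nonneg : ∀ k, 0 ≤ p k
  hasSum : HasSum p 1
  hasSum_mean : HasSum (fun k : ℕ => k * p k) lam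
  summable_sq : Summable fun k : ℕ => (k : ℝ) ^ 2 * p k
  exists_pos : ∃ l, 0 < p l ∧ 0 < p (l + 1)

/-- The tail sum `∑_{k > K} p_k`. -/
noncomputable def tailSum (p : ℕ → ℝ) (K : ℕ) : ℝ := ∑' k, p (k + (K + 1))

/-- The second moment `∑_k p_k (k - c)²` of `p` about `c`: the variance if `c` is the mean. -/
noncomputable def secondMoment (p : ℕ → ℝ) (c : ℝ) : ℝ := ∑' k : ℕ, p k * (k - c) ^ 2

/-- The integrand of Fourier inversion for `truncPartition p K m n` after the substitution
`θ = x / √n`, extended by zero and normalized by `exp (n * tailSum p K)`, the reciprocal of the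
order of the probability that `n` variables are all at most `K`. -/
noncomputable def rescaledIntegrand (p : ℕ → ℝ) (K m n : ℕ) : ℝ → ℂ :=
  Set.indicator (Set.Ioc (-(Real.pi * √n)) (Real.pi * √n)) fun x =>
    truncChar p K (x / √n) ^ n * Complex.exp (-(Complex.I * ((m * (x / √n) : ℝ) : ℂ))) *
      Complex.exp ((n * tailSum p K : ℝ) : ℂ)

theorem tailSum_nonneg {p : ℕ → ℝ} (hp : ∀ k, 0 ≤ p k) (K : ℕ) : 0 ≤ tailSum p K :=
  tsum_nonneg fun _ => hp _

theorem tendsto_tsum_add_mul_sq (p : ℕ → ℝ) (c : ℝ) :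
    Tendsto (fun K => ∑' k : ℕ, p (k + (K + 1)) * (((k + (K + 1) : ℕ) : ℝ) - c) ^ 2)
      atTop (𝓝 0) :=
  (tendsto_sum_nat_add fun k : ℕ => p k * ((k : ℝ) - c) ^ 2).comp (tendsto_add_atTop_nat 1)

theorem tendsto_sq_mul_tailSum {p : ℕ → ℝ} (hp : ∀ k, 0 ≤ p k) (hs : Summable p)
    (hsq : Summable fun k : ℕ => (k : ℝ) ^ 2 * p k) :
    Tendsto (fun K : ℕ => (K : ℝ) ^ 2 * tailSum p K) atTop (𝓝 0) := by
  have hsq' : Summable fun k : ℕ => p k * ((k : ℝ) - 0) ^ 2 :=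
    hsq.congr fun k => by ring
  have markov (K : ℕ) : (K : ℝ) ^ 2 * tailSum p K ≤
      ∑' k : ℕ, p (k + (K + 1)) * (((k + (K + 1) : ℕ) : ℝ) - 0) ^ 2 := by
    rw [tailSum, ← tsum_mul_left]
    refine ((hs.comp_injective (add_left_injective (K + 1))).mul_left _).tsum_le_tsum (fun k => ?_)
      (hsq'.comp_injective (add_left_injective (K + 1)))
    rw [mul_comm, sub_zero]
    refine mul_le_mul_of_nonneg_left (pow_le_pow_left₀ K.cast_nonneg ?_ 2) (hp _)
    exact Nat.cast_le.2 (by lia)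
  exact squeeze_zero (fun K => mul_nonneg (sq_nonneg _) (tailSum_nonneg hp K)) markov
    (tendsto_tsum_add_mul_sq p 0)

theorem integral_rescaledIntegrand (p : ℕ → ℝ) (K m : ℕ) {n : ℕ} (hn : 0 < n) :
    ∫ x, rescaledIntegrand p K m n x =
      ((√n * (2 * Real.pi * truncPartition p K m n) * Real.exp (n * tailSum p K) : ℝ) : ℂ) := by
  have sqrt_pos : 0 < √(n : ℝ) := Real.sqrt_pos.2 (mod_cast hn)
  have endpoints_le : -(Real.pi * √n) ≤ Real.pi * √n := neg_le_self (by positivity)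
  unfold rescaledIntegrand
  rw [integral_indicator measurableSet_Ioc, ← intervalIntegral.integral_of_le endpoints_le,
    intervalIntegral.integral_mul_const, intervalIntegral.integral_comp_div (fun θ : ℝ =>
      truncChar p K θ ^ n * Complex.exp (-(Complex.I * ((m * θ : ℝ) : ℂ)))) sqrt_pos.ne',
    neg_div, mul_div_cancel_right₀ _ sqrt_pos.ne', ← truncPartition_eq_integral,
    Complex.real_smul, ← Complex.ofReal_exp]
  push_cast
  ring

theorem norm_rescaledIntegrand_le {p : ℕ → ℝ} {c C : ℝ} {K m n : ℕ} (hn : 0 < n)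
    (hchar : ∀ θ : ℝ, |θ| ≤ Real.pi → ‖truncChar p K θ‖ ≤ Real.exp (-(c * θ ^ 2)))
    (htail : n * tailSum p K ≤ C) (x : ℝ) :
    ‖rescaledIntegrand p K m n x‖ ≤ Real.exp (-c * x ^ 2) * Real.exp C := by
  have sqrt_pos : 0 < √(n : ℝ) := Real.sqrt_pos.2 (mod_cast hn)
  unfold rescaledIntegrand
  by_cases hx : x ∈ Set.Ioc (-(Real.pi * √n)) (Real.pi * √n)
  · have abs_le_pi : |x / √n| ≤ Real.pi := by
      rw [abs_div, abs_of_pos sqrt_pos, div_le_iff₀ sqrt_pos, abs_le]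
      exact ⟨hx.1.le, hx.2⟩
    have norm_phase : ‖Complex.exp (-(Complex.I * ((m * (x / √n) : ℝ) : ℂ)))‖ = 1 := by
      rw [← mul_neg, ← Complex.ofReal_neg, Complex.norm_exp_I_mul_ofReal]
    rw [Set.indicator_of_mem hx, norm_mul, norm_mul, norm_phase, mul_one, norm_pow,
      ← Complex.ofReal_exp, Complex.norm_of_nonneg (Real.exp_pos _).le]
    gcongr
    calc ‖truncChar p K (x / √n)‖ ^ n ≤ Real.exp (-(c * (x / √n) ^ 2)) ^ n := by
          gcongr
          exact hchar _ abs_le_pi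
      _ = Real.exp (-c * x ^ 2) := by
          rw [← Real.exp_nat_mul, div_pow, Real.sq_sqrt n.cast_nonneg]
          field_simp
  · rw [Set.indicator_of_notMem hx, norm_zero]
    positivity

namespace LatticeLaw

variable {p : ℕ → ℝ} {lam : ℝ}

theorem summable_mul_sub_sq (h : LatticeLaw p lam) (c : ℝ) :
    Summable fun k : ℕ => p k * ((k : ℝ) - c) ^ 2 := by
  refine ((h.summable_sq.sub (h.hasSum_mean.summable.mul_left (2 * c))).add
    (h.hasSum.summable.mul_left (c ^ 2))).congr fun k => by ring

theorem mean_pos (h : LatticeLaw p lam) : 0 < lam := by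
  obtain ⟨l, -, hl⟩ := h.exists_pos
  rw [← h.hasSum_mean.tsum_eq]
  exact h.hasSum_mean.summable.tsum_pos (fun k => mul_nonneg k.cast_nonneg (h.nonneg k)) (l + 1)
    (by positivity)

theorem secondMoment_pos (h : LatticeLaw p lam) (c : ℝ) : 0 < secondMoment p c := by
  obtain ⟨l, hl, hl'⟩ := h.exists_pos
  have pos_of_ne {k : ℕ} (hk : 0 < p k) (hne : (k : ℝ) ≠ c) : 0 < secondMoment p c :=
    (h.summable_mul_sub_sq c).tsum_pos (fun k => mul_nonneg (h.nonneg k) (sq_nonneg _)) k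
      (mul_pos hk (by have := sub_ne_zero.2 hne; positivity))
  by_cases hlc : (l : ℝ) = c
  · exact pos_of_ne hl' (by rw [← hlc]; simp)
  · exact pos_of_ne hl hlc

theorem summable_mul_exp (h : LatticeLaw p lam) (f : ℕ → ℝ) :
    Summable fun k : ℕ => (p k : ℂ) * Complex.exp (Complex.I * (f k : ℂ)) := by
  refine Summable.of_norm (h.hasSum.summable.congr fun k => ?_)
  rw [norm_mul, Complex.norm_exp_I_mul_ofReal, mul_one, Complex.norm_of_nonneg (h.nonneg k)]

theorem hasSum_mul_I_mul_sub (h : LatticeLaw p lam) (θ : ℝ) :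
    HasSum (fun k : ℕ => (p k : ℂ) * (Complex.I * ((((k : ℝ) - lam) * θ : ℝ) : ℂ))) 0 := by
  have := (Complex.hasSum_ofReal.2
    ((h.hasSum_mean.sub (h.hasSum.mul_left lam)).mul_right θ)).mul_left Complex.I
  simp only [mul_one, sub_self, zero_mul, Complex.ofReal_zero, mul_zero] at this
  refine this.congr_fun fun k => ?_
  push_cast
  ring

theorem truncChar_mul_exp_sub_one_add_tailSum (h : LatticeLaw p lam) (K : ℕ) (θ : ℝ) :
    truncChar p K θ * Complex.exp (-(Complex.I * ((lam * θ : ℝ) : ℂ))) - 1 + (tailSum p K : ℂ) =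
      ∑' k : ℕ, (p k : ℂ) * (Complex.exp (Complex.I * ((((k : ℝ) - lam) * θ : ℝ) : ℂ)) - 1 -
        Complex.I * ((((k : ℝ) - lam) * θ : ℝ) : ℂ)) -
      ∑' k : ℕ, (p (k + (K + 1)) : ℂ) *
        (Complex.exp (Complex.I * (((((k + (K + 1) : ℕ) : ℝ) - lam) * θ : ℝ) : ℂ)) - 1) := by
  have total : HasSum (fun k => (p k : ℂ)) 1 := by simpa using Complex.hasSum_ofReal.2 h.hasSum
  have linear := h.hasSum_mul_I_mul_sub θ
  have char := h.summable_mul_exp fun k => ((k : ℝ) - lam) * θ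
  have centered : truncChar p K θ * Complex.exp (-(Complex.I * ((lam * θ : ℝ) : ℂ))) =
      ∑ k ∈ Finset.range (K + 1),
        (p k : ℂ) * Complex.exp (Complex.I * ((((k : ℝ) - lam) * θ : ℝ) : ℂ)) := by
    rw [truncChar, Finset.sum_mul]
    refine Finset.sum_congr rfl fun k _ => ?_
    rw [mul_assoc, ← Complex.exp_add]
    push_cast
    ring_nf
  simp_rw [mul_sub, mul_one]
  rw [(char.sub total.summable).tsum_sub linear.summable, char.tsum_sub total.summable,
    linear.tsum_eq, total.tsum_eq, ((summable_nat_add_iff (K + 1)).2 char).tsum_sub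
      ((summable_nat_add_iff (K + 1)).2 total.summable),
    tailSum, Complex.ofReal_tsum, centered, ← char.sum_add_tsum_nat_add (K + 1)]
  ring

theorem tendsto_mul_tsum_exp_sub_one_sub (h : LatticeLaw p lam) (x : ℝ) :
    Tendsto (fun n : ℕ => (n : ℂ) * ∑' k : ℕ, (p k : ℂ) *
      (Complex.exp (Complex.I * ((((k : ℝ) - lam) * (x / √n) : ℝ) : ℂ)) - 1 -
        Complex.I * ((((k : ℝ) - lam) * (x / √n) : ℝ) : ℂ))) atTop
      (𝓝 ((-(secondMoment p lam / 2 * x ^ 2) : ℝ) : ℂ)) := by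
  have limit_eq : ((-(secondMoment p lam / 2 * x ^ 2) : ℝ) : ℂ) =
      ∑' k : ℕ, (p k : ℂ) * ((Complex.I * ((k - lam) * x : ℝ)) ^ 2 / 2) := by
    rw [show -(secondMoment p lam / 2 * x ^ 2) = -(x ^ 2 / 2) * secondMoment p lam by ring,
      secondMoment, ← tsum_mul_left, Complex.ofReal_tsum]
    refine tsum_congr fun k => ?_
    push_cast
    rw [mul_pow, Complex.I_sq]
    ring
  rw [limit_eq]
  simp_rw [← tsum_mul_left]
  refine tendsto_tsum_of_dominated_convergence
    ((h.summable_mul_sub_sq lam).mul_left (2 * x ^ 2)) (fun k => ?_) ?_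
  · refine ((tendsto_mul_exp_div_sqrt_sub_one_sub
      (Complex.I * ((k - lam) * x : ℝ))).const_mul (p k : ℂ)).congr fun n => ?_
    rw [← mul_div_assoc, Complex.ofReal_div, mul_div_assoc Complex.I]
    ring
  · filter_upwards [eventually_gt_atTop 0] with n hn k
    rw [norm_mul, norm_mul, Complex.norm_natCast, Complex.norm_of_nonneg (h.nonneg k)]
    calc (n : ℝ) * (p k * _) ≤ n * (p k * (2 * (((k : ℝ) - lam) * (x / √n)) ^ 2)) := by
          gcongr
          · exact h.nonneg k
          · exact norm_exp_I_mul_sub_one_sub_le _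
      _ = 2 * x ^ 2 * (p k * ((k : ℝ) - lam) ^ 2) := by
          rw [mul_pow, div_pow, Real.sq_sqrt n.cast_nonneg]
          field_simp

theorem tendsto_mul_tsum_add_exp_sub_one (h : LatticeLaw p lam) {K : ℕ → ℕ}
    (hK : Tendsto K atTop atTop)
    (htail : (fun n : ℕ => n * tailSum p (K n)) =O[atTop] fun _ => (1 : ℝ)) (x : ℝ) :
    Tendsto (fun n : ℕ => (n : ℂ) * ∑' k : ℕ, (p (k + (K n + 1)) : ℂ) *
        (Complex.exp (Complex.I * (((((k + (K n + 1) : ℕ) : ℝ) - lam) * (x / √n) : ℝ) : ℂ)) - 1))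
      atTop (𝓝 0) := by
  set V : ℕ → ℝ := fun n =>
    ∑' k : ℕ, p (k + (K n + 1)) * (((k + (K n + 1) : ℕ) : ℝ) - lam) ^ 2
  have bound_tendsto :
      Tendsto (fun n : ℕ => √(n * tailSum p (K n) * (x ^ 2 * V n))) atTop (𝓝 0) := by
    have hV := ((tendsto_tsum_add_mul_sq p lam).comp hK).const_mul (x ^ 2)
    rw [mul_zero] at hV
    have := (isBoundedUnder_le_mul_tendsto_zero htail.isBoundedUnder_le hV).sqrt
    rwa [Real.sqrt_zero] at this
  refine squeeze_zero_norm' ?_ bound_tendsto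
  filter_upwards [eventually_gt_atTop 0] with n hn
  have hn' : (0 : ℝ) < n := mod_cast hn
  have sq_eq (k : ℕ) : p (k + (K n + 1)) *
      ((((k + (K n + 1) : ℕ) : ℝ) - lam) * (x / √n)) ^ 2 =
      x ^ 2 / n * (p (k + (K n + 1)) * (((k + (K n + 1) : ℕ) : ℝ) - lam) ^ 2) := by
    rw [mul_pow, div_pow, Real.sq_sqrt hn'.le]
    ring
  have cauchy_schwarz := norm_tsum_mul_exp_I_sub_one_le (p := fun k => p (k + (K n + 1)))
    (d := fun k => (((k + (K n + 1) : ℕ) : ℝ) - lam) * (x / √n)) (fun _ => h.nonneg _)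
    ((summable_nat_add_iff (K n + 1)).2 h.hasSum.summable)
    (by simpa only [sq_eq] using
      ((summable_nat_add_iff (K n + 1)).2 (h.summable_mul_sub_sq lam)).mul_left (x ^ 2 / n))
  simp only [sq_eq, tsum_mul_left] at cauchy_schwarz
  rw [norm_mul, Complex.norm_natCast]
  refine (mul_le_mul_of_nonneg_left cauchy_schwarz hn'.le).trans_eq ?_
  have tail_nonneg := tailSum_nonneg h.nonneg (K n)
  rw [← tailSum, ← Real.sqrt_mul tail_nonneg, ← Real.sqrt_sq hn'.le, ← Real.sqrt_mul (sq_nonneg _),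
    Real.sqrt_sq hn'.le]
  congr 1
  simp only [V]
  field_simp

theorem tendsto_rescaledIntegrand (h : LatticeLaw p lam) {K m : ℕ → ℕ}
    (hK : Tendsto K atTop atTop)
    (htail : (fun n : ℕ => n * tailSum p (K n)) =O[atTop] fun _ => (1 : ℝ))
    (hm : (fun n : ℕ => (m n : ℝ) - lam * n) =o[atTop] (fun n : ℕ => √(n : ℝ))) (x : ℝ) :
    Tendsto (fun n : ℕ => rescaledIntegrand p (K n) (m n) n x) atTop
      (𝓝 ((Real.exp (-(secondMoment p lam / 2) * x ^ 2) : ℝ) : ℂ)) := by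
  have log_limit : Tendsto (fun n : ℕ => (n : ℂ) * (truncChar p (K n) (x / √n) *
      Complex.exp (-(Complex.I * ((lam * (x / √n) : ℝ) : ℂ))) - 1) +
      ((n * tailSum p (K n) : ℝ) : ℂ)) atTop
      (𝓝 ((-(secondMoment p lam / 2 * x ^ 2) : ℝ) : ℂ)) := by
    have := (h.tendsto_mul_tsum_exp_sub_one_sub x).sub
      (h.tendsto_mul_tsum_add_exp_sub_one hK htail x)
    rw [sub_zero] at this
    refine this.congr fun n => ?_
    rw [← mul_sub, ← h.truncChar_mul_exp_sub_one_add_tailSum]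
    push_cast
    ring
  have phase_limit : Tendsto (fun n : ℕ => Complex.exp (-(Complex.I *
      ((((m n - lam * n) / √n * x : ℝ)) : ℂ)))) atTop (𝓝 1) := by
    have exp_continuous : Continuous fun y : ℝ => Complex.exp (-(Complex.I * (y : ℂ))) := by
      fun_prop
    simpa [Function.comp_def] using
      (exp_continuous.tendsto _).comp (hm.tendsto_div_nhds_zero.mul_const x)
  have limit := (tendsto_pow_mul_exp
    (IsBigO.of_norm_left (by simpa using htail.norm_left)) log_limit).mul phase_limit
  rw [mul_one, ← Complex.ofReal_exp, ← neg_mul] at limit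
  refine limit.congr' ?_
  have endpoint_tendsto : Tendsto (fun n : ℕ => Real.pi * √(n : ℝ)) atTop atTop :=
    (Real.tendsto_sqrt_atTop.comp tendsto_natCast_atTop_atTop).const_mul_atTop Real.pi_pos
  filter_upwards [endpoint_tendsto.eventually_gt_atTop |x|] with n hn
  have mem_Ioc := And.imp_right le_of_lt (abs_lt.1 hn)
  rw [rescaledIntegrand, Set.indicator_of_mem (Set.mem_Ioc.2 mem_Ioc), mul_pow,
    ← Complex.exp_nat_mul, mul_right_comm (_ * _), mul_assoc (_ ^ n), ← Complex.exp_add]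
  congr 3
  push_cast
  ring

theorem tendsto_sqrt_mul_truncPartition_mul_exp (h : LatticeLaw p lam) {K m : ℕ → ℕ}
    (hK : Tendsto K atTop atTop)
    (htail : (fun n : ℕ => n * tailSum p (K n)) =O[atTop] fun _ => (1 : ℝ))
    (hm : (fun n : ℕ => (m n : ℝ) - lam * n) =o[atTop] (fun n : ℕ => √(n : ℝ))) :
    Tendsto (fun n : ℕ => √n * truncPartition p (K n) (m n) n * Real.exp (n * tailSum p (K n)))
      atTop (𝓝 (√(2 * Real.pi * secondMoment p lam))⁻¹) := by
  obtain ⟨l, hl, hl'⟩ := h.exists_pos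
  obtain ⟨c, hc, hchar⟩ := exists_norm_truncChar_le_exp h.nonneg h.hasSum hl hl'
  obtain ⟨C, hC⟩ := htail.bound
  have integral_tendsto : Tendsto (fun n => ∫ x, rescaledIntegrand p (K n) (m n) n x) atTop
      (𝓝 (∫ x : ℝ, ((Real.exp (-(secondMoment p lam / 2) * x ^ 2) : ℝ) : ℂ))) := by
    refine tendsto_integral_filter_of_dominated_convergence
      (fun x => Real.exp (-c * x ^ 2) * Real.exp C) (Eventually.of_forall fun n => ?_) ?_
      ((integrable_exp_neg_mul_sq hc).mul_const _)
      (Eventually.of_forall (h.tendsto_rescaledIntegrand hK htail hm))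
    · exact (Continuous.aestronglyMeasurable (by fun_prop)).indicator measurableSet_Ioc
    · filter_upwards [hK.eventually_ge_atTop (l + 1), eventually_gt_atTop 0, hC] with n hKn hn hCn
      refine Eventually.of_forall (norm_rescaledIntegrand_le hn (hchar _ hKn) ?_)
      simpa using (le_abs_self _).trans hCn
  rw [integral_complex_ofReal, integral_gaussian] at integral_tendsto
  have real_tendsto := ((Complex.continuous_re.tendsto _).comp integral_tendsto).div_const
    (2 * Real.pi)
  have hσ := h.secondMoment_pos lam
  have limit_eq : √(Real.pi / (secondMoment p lam / 2)) / (2 * Real.pi) =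
      (√(2 * Real.pi * secondMoment p lam))⁻¹ := by
    rw [div_eq_iff (by positivity), ← Real.sqrt_inv,
      ← Real.sqrt_sq (show 0 ≤ 2 * Real.pi by positivity), ← Real.sqrt_mul (by positivity)]
    congr 1
    rw [Real.sqrt_sq (by positivity)]
    field_simp
  rw [Complex.ofReal_re, limit_eq] at real_tendsto
  refine real_tendsto.congr' ?_
  filter_upwards [eventually_gt_atTop 0] with n hn
  rw [Function.comp_apply, integral_rescaledIntegrand _ _ _ hn, Complex.ofReal_re]
  field_simp

end LatticeLaw

theorem eventually_half_mul_le {lam : ℝ} (hlam : 0 < lam) {m : ℕ → ℕ}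
    (hm : (fun n : ℕ => (m n : ℝ) - lam * n) =o[atTop] (fun n : ℕ => √(n : ℝ))) :
    ∀ᶠ n : ℕ in atTop, lam / 2 * n ≤ m n := by
  filter_upwards [hm.bound (half_pos hlam), eventually_ge_atTop 1] with n hn hn1
  have sqrt_le : √(n : ℝ) ≤ n := by
    rw [Real.sqrt_le_left n.cast_nonneg]
    exact le_self_pow₀ (mod_cast hn1) two_ne_zero
  rw [Real.norm_eq_abs, Real.norm_of_nonneg (Real.sqrt_nonneg _)] at hn
  nlinarith [(abs_le.1 hn).1]

namespace LatticeLaw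

variable {p : ℕ → ℝ} {lam : ℝ}

theorem tendsto_balls_atTop (h : LatticeLaw p lam) {m : ℕ → ℕ}
    (hm : (fun n : ℕ => (m n : ℝ) - lam * n) =o[atTop] (fun n : ℕ => √(n : ℝ))) :
    Tendsto m atTop atTop := by
  rw [← tendsto_natCast_atTop_iff (R := ℝ)]
  exact tendsto_atTop_mono' _ (eventually_half_mul_le h.mean_pos hm)
    (tendsto_natCast_atTop_atTop.const_mul_atTop (half_pos h.mean_pos))

theorem tendsto_mul_tailSum_balls (h : LatticeLaw p lam) {m : ℕ → ℕ}
    (hm : (fun n : ℕ => (m n : ℝ) - lam * n) =o[atTop] (fun n : ℕ => √(n : ℝ))) :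
    Tendsto (fun n : ℕ => n * tailSum p (m n)) atTop (𝓝 0) := by
  have lam_pos := h.mean_pos
  have bound_tendsto := ((tendsto_sq_mul_tailSum h.nonneg h.hasSum.summable h.summable_sq).comp
    (h.tendsto_balls_atTop hm)).const_mul (4 / lam ^ 2)
  rw [mul_zero] at bound_tendsto
  refine squeeze_zero' (Eventually.of_forall fun n =>
    mul_nonneg n.cast_nonneg (tailSum_nonneg h.nonneg _)) ?_ bound_tendsto
  filter_upwards [eventually_half_mul_le lam_pos hm, eventually_ge_atTop 1] with n hn hn1
  rw [Function.comp_apply, ← mul_assoc]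
  refine mul_le_mul_of_nonneg_right ?_ (tailSum_nonneg h.nonneg _)
  calc (n : ℝ) ≤ n ^ 2 := le_self_pow₀ (mod_cast hn1) two_ne_zero
    _ = 4 / lam ^ 2 * (lam / 2 * n) ^ 2 := by
      field_simp
      norm_num
    _ ≤ 4 / lam ^ 2 * m n ^ 2 := by gcongr

theorem tendsto_sqrt_mul_truncPartition (h : LatticeLaw p lam) {m : ℕ → ℕ}
    (hm : (fun n : ℕ => (m n : ℝ) - lam * n) =o[atTop] (fun n : ℕ => √(n : ℝ))) :
    Tendsto (fun n : ℕ => √n * truncPartition p (m n) (m n) n)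
      atTop (𝓝 (√(2 * Real.pi * secondMoment p lam))⁻¹) := by
  have tail := h.tendsto_mul_tailSum_balls hm
  have exp_tendsto := (Real.continuous_exp.tendsto 0).comp tail
  rw [Real.exp_zero] at exp_tendsto
  have limit := (h.tendsto_sqrt_mul_truncPartition_mul_exp (h.tendsto_balls_atTop hm)
    (tail.isBigO_one ℝ) hm).div exp_tendsto one_ne_zero
  rw [div_one] at limit
  exact limit.congr fun n => mul_div_cancel_right₀ _ (Real.exp_ne_zero _)

theorem eventually_truncPartition_pos (h : LatticeLaw p lam) {m : ℕ → ℕ}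
    (hm : (fun n : ℕ => (m n : ℝ) - lam * n) =o[atTop] (fun n : ℕ => √(n : ℝ))) :
    ∀ᶠ n in atTop, 0 < truncPartition p (m n) (m n) n := by
  have limit_pos : 0 < (√(2 * Real.pi * secondMoment p lam))⁻¹ := by
    have := h.secondMoment_pos lam
    positivity
  filter_upwards [(h.tendsto_sqrt_mul_truncPartition hm).eventually_const_lt limit_pos] with n hn
  exact pos_of_mul_pos_right hn (Real.sqrt_nonneg _)

theorem tendsto_truncPartition_div_sub_exp (h : LatticeLaw p lam) {K m : ℕ → ℕ}
    (hK : Tendsto K atTop atTop)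
    (htail : (fun n : ℕ => n * tailSum p (K n)) =O[atTop] fun _ => (1 : ℝ))
    (hm : (fun n : ℕ => (m n : ℝ) - lam * n) =o[atTop] (fun n : ℕ => √(n : ℝ))) :
    Tendsto (fun n : ℕ => truncPartition p (K n) (m n) n / truncPartition p (m n) (m n) n -
      Real.exp (-(n * tailSum p (K n)))) atTop (𝓝 0) := by
  have limit_ne : (√(2 * Real.pi * secondMoment p lam))⁻¹ ≠ 0 := by
    have := h.secondMoment_pos lam
    positivity
  have ratio := ((h.tendsto_sqrt_mul_truncPartition_mul_exp hK htail hm).div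
    (h.tendsto_sqrt_mul_truncPartition hm) limit_ne).sub_const 1
  rw [div_self limit_ne, sub_self] at ratio
  have exp_le_one (n : ℕ) : ‖Real.exp (-(n * tailSum p (K n)))‖ ≤ 1 := by
    rw [Real.norm_of_nonneg (Real.exp_pos _).le, Real.exp_le_one_iff, neg_nonpos]
    exact mul_nonneg n.cast_nonneg (tailSum_nonneg h.nonneg _)
  refine (isBoundedUnder_le_mul_tendsto_zero (isBoundedUnder_of ⟨1, exp_le_one⟩) ratio).congr' ?_
  filter_upwards [h.eventually_truncPartition_pos hm, eventually_gt_atTop 0] with n hpos hn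
  have : 0 < √(n : ℝ) := Real.sqrt_pos.2 (mod_cast hn)
  rw [Pi.div_apply, Real.exp_neg]
  field_simp

end LatticeLaw

/-! ### The maximal occupancy -/

theorem truncPartition_mul_pow_div (w : ℕ → ℝ) (t s : ℝ) (K m n : ℕ) :
    truncPartition (fun k => w k * t ^ k / s) K m n = t ^ m / s ^ n * truncPartition w K m n := by
  rw [truncPartition, truncPartition, Finset.mul_sum]
  refine Finset.sum_congr rfl fun y hy => ?_
  have sum_eq : ∑ i, y i = m := by
    simpa [allocations] using (Finset.mem_filter.1 hy).1
  rw [Finset.prod_div_distrib, Finset.prod_mul_distrib, Finset.prod_pow_eq_pow_sum, sum_eq,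
    Finset.prod_const, Finset.card_univ, Fintype.card_fin]
  ring

theorem coe_partitionFun (w : ℕ → ℝ≥0) (m n : ℕ) :
    (partitionFun w m n : ℝ) = truncPartition (fun k => w k) m m n := by
  rw [truncPartition, Finset.filter_true_of_mem, partitionFun]
  · simp [weight]
  · intro y hy i
    have sum_eq : ∑ i, y i = m := by simpa [allocations] using hy
    rw [← sum_eq]
    exact Finset.single_le_sum (fun _ _ => Nat.zero_le _) (Finset.mem_univ i)

theorem randomAllocation_apply {w : ℕ → ℝ≥0} {m n : ℕ} (hZ : partitionFun w m n ≠ 0)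
    {y : Fin n → ℕ} (hy : y ∈ allocations m n) :
    randomAllocation w m n y = (weight w y / partitionFun w m n : ℝ≥0) := by
  rw [randomAllocation, dif_neg hZ, PMF.ofFinset_apply, if_pos hy]

theorem randomAllocation_apply_of_notMem {w : ℕ → ℝ≥0} {m n : ℕ} (hZ : partitionFun w m n ≠ 0)
    {y : Fin n → ℕ} (hy : y ∉ allocations m n) : randomAllocation w m n y = 0 := by
  rw [randomAllocation, dif_neg hZ, PMF.ofFinset_apply, if_neg hy]

theorem maxOccupancy_real_Iic {w : ℕ → ℝ≥0} {m n : ℕ} (hZ : partitionFun w m n ≠ 0) (K : ℕ) :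
    (maxOccupancy w m n).toMeasure.real (Set.Iic (K : ℤ)) =
      truncPartition (fun k => w k) K m n / partitionFun w m n := by
  have preimage_eq : (fun y : Fin n → ℕ => ((Finset.univ.sup y : ℕ) : ℤ)) ⁻¹' Set.Iic (K : ℤ) =
      {y | ∀ i, y i ≤ K} := by
    ext y
    simp
  rw [measureReal_def, PMF.toMeasure_apply_eq_toOuterMeasure_apply _ measurableSet_Iic,
    maxOccupancy, PMF.toOuterMeasure_map_apply, preimage_eq, PMF.toOuterMeasure_apply,
    tsum_eq_sum (s := (allocations m n).filter (fun y => ∀ i, y i ≤ K))]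
  · have indicator_eq : ∀ y ∈ (allocations m n).filter (fun y => ∀ i, y i ≤ K),
        {y : Fin n → ℕ | ∀ i, y i ≤ K}.indicator (randomAllocation w m n) y =
          ((weight w y / partitionFun w m n : ℝ≥0) : ℝ≥0∞) := fun y hy => by
      rw [Finset.mem_filter] at hy
      rw [Set.indicator_of_mem (by exact hy.2), randomAllocation_apply hZ hy.1]
    rw [Finset.sum_congr rfl indicator_eq, ← ENNReal.ofNNReal_finsetSum, ENNReal.coe_toReal,
      ← Finset.sum_div, truncPartition]
    simp [weight]
  · intro y hy
    rw [Finset.mem_filter, not_and] at hy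
    refine Set.indicator_apply_eq_zero.2 fun hle => ?_
    exact randomAllocation_apply_of_notMem hZ fun hmem => hy hmem hle

/-! ### Total variation distance -/

section TotalVariation

variable {α : Type*} [MeasurableSpace α]

theorem tvDist_nonneg (μ ν : Measure α) : 0 ≤ tvDist μ ν :=
  Real.iSup_nonneg fun _ => abs_nonneg _

theorem abs_real_sub_le_tvDist (μ ν : Measure α) [IsProbabilityMeasure μ]
    [IsProbabilityMeasure ν] {A : Set α} (hA : MeasurableSet A) :
    |μ.real A - ν.real A| ≤ tvDist μ ν := by
  refine le_ciSup (f := fun A : {A : Set α // MeasurableSet A} =>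
    |μ.real (A : Set α) - ν.real (A : Set α)|) ⟨1, ?_⟩ ⟨A, hA⟩
  rintro _ ⟨A, rfl⟩
  exact abs_sub_le_of_nonneg_of_le measureReal_nonneg measureReal_le_one measureReal_nonneg
    measureReal_le_one

theorem tendsto_of_dApprox [TopologicalSpace α] [OpensMeasurableSpace α]
    [HasOuterApproxClosed α] {P : ℕ → ProbabilityMeasure α} {L : ProbabilityMeasure α}
    (h : DApprox (fun n => (P n : Measure α)) (fun _ => (L : Measure α))) :
    Tendsto P atTop (𝓝 L) := by
  refine tendsto_of_forall_isOpen_le_liminf' fun G hG => ?_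
  have real_tendsto :
      Tendsto (fun n => (P n : Measure α).real G) atTop (𝓝 ((L : Measure α).real G)) := by
    rw [tendsto_iff_norm_sub_tendsto_zero]
    exact squeeze_zero (fun _ => norm_nonneg _)
      (fun n => abs_real_sub_le_tvDist _ _ hG.measurableSet) h
  exact ((ENNReal.tendsto_toReal_iff (fun _ => measure_ne_top _ _)
    (measure_ne_top _ _)).1 real_tendsto).liminf_eq.ge

variable [MeasurableSingletonClass α]

theorem sum_filter_real_singleton_mem_Icc (μ : Measure α) [IsProbabilityMeasure μ] (A : Set α)
    [DecidablePred (· ∈ A)] (D : Finset α) :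
    ∑ x ∈ D with x ∈ A, μ.real {x} ∈ Set.Icc (μ.real A - (1 - μ.real D)) (μ.real A) := by
  have inter_eq : ((D.filter (· ∈ A) : Finset α) : Set α) = A ∩ D := by
    ext x
    simp [and_comm]
  have diff_le : μ.real (A \ D) ≤ 1 - μ.real D := by
    rw [← probReal_compl_eq_one_sub D.measurableSet]
    exact measureReal_mono fun x hx => hx.2
  have split : μ.real (A ∩ D) + μ.real (A \ D) = μ.real A :=
    measureReal_inter_add_sdiff D.measurableSet
  rw [sum_measureReal_singleton, inter_eq]
  constructor
  · linarith
  · exact measureReal_mono Set.inter_subset_left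

theorem abs_real_sub_le (μ ν : Measure α) [IsProbabilityMeasure μ] [IsProbabilityMeasure ν]
    (A : Set α) (D : Finset α) :
    |μ.real A - ν.real A| ≤
      ∑ x ∈ D, |μ.real {x} - ν.real {x}| + (1 - μ.real D) + (1 - ν.real D) := by
  classical
  obtain ⟨μ_ge, μ_le⟩ := sum_filter_real_singleton_mem_Icc μ A D
  obtain ⟨ν_ge, ν_le⟩ := sum_filter_real_singleton_mem_Icc ν A D
  have sum_sub_le : |∑ x ∈ D with x ∈ A, μ.real {x} - ∑ x ∈ D with x ∈ A, ν.real {x}| ≤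
      ∑ x ∈ D, |μ.real {x} - ν.real {x}| := by
    rw [← Finset.sum_sub_distrib]
    refine (Finset.abs_sum_le_sum_abs _ _).trans ?_
    exact Finset.sum_le_sum_of_subset_of_nonneg (Finset.filter_subset _ _)
      fun _ _ _ => abs_nonneg _
  have μ_le_one : μ.real D ≤ 1 := measureReal_le_one
  have ν_le_one : ν.real D ≤ 1 := measureReal_le_one
  rw [abs_le] at sum_sub_le ⊢
  constructor <;> linarith [sum_sub_le.1, sum_sub_le.2]

theorem tvDist_le (μ ν : Measure α) [IsProbabilityMeasure μ] [IsProbabilityMeasure ν]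
    (D : Finset α) :
    tvDist μ ν ≤ ∑ x ∈ D, |μ.real {x} - ν.real {x}| + (1 - μ.real D) + (1 - ν.real D) :=
  have : Nonempty {A : Set α // MeasurableSet A} := ⟨⟨∅, MeasurableSet.empty⟩⟩
  ciSup_le fun A => abs_real_sub_le μ ν A D

end TotalVariation

/-! ### Laws on `ℤ` with asymptotically Gumbel distribution functions -/

/-- The laws `μ n` on `ℤ`, recentred at `κ n`, have asymptotically the distribution functions
`j ↦ exp (-B n * q ^ (j + 1))`, which are those of `⌊(W + log (B n)) / log (1 / q)⌋` for a Gumbel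
variable `W`. Since `B n` is allowed to oscillate, no limit law is assumed to exist. -/
def HasGumbelCDF (q : ℝ) (B : ℕ → ℝ) (κ : ℕ → ℤ) (μ : ℕ → Measure ℤ) : Prop :=
  ∀ j : ℤ, Tendsto (fun n => (μ n).real (Set.Iic (κ n + j)) - Real.exp (-(B n * q ^ (j + 1))))
    atTop (𝓝 0)

theorem real_Ioc_eq_sub {α : Type*} [LinearOrder α] [TopologicalSpace α] [OrderClosedTopology α]
    [MeasurableSpace α] [OpensMeasurableSpace α] (μ : Measure α) [IsFiniteMeasure μ] {a b : α}
    (hab : a ≤ b) : μ.real (Set.Ioc a b) = μ.real (Set.Iic b) - μ.real (Set.Iic a) := by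
  rw [← Set.Iic_sdiff_Iic, measureReal_sdiff (Set.Iic_subset_Iic.2 hab) measurableSet_Iic]

theorem real_singleton_int_eq_sub (μ : Measure ℤ) [IsFiniteMeasure μ] (a : ℤ) :
    μ.real {a} = μ.real (Set.Iic a) - μ.real (Set.Iic (a - 1)) := by
  rw [← real_Ioc_eq_sub μ (sub_one_lt a).le, ← Order.Icc_succ_left]
  simp [Order.succ_eq_add_one]

section

variable {q : ℝ}

theorem tendsto_exp_neg_mul_zpow_neg_add_one (hq0 : 0 < q) (hq1 : q < 1) {c : ℝ} (hc : 0 < c) :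
    Tendsto (fun J : ℕ => Real.exp (-(c * q ^ (-(J : ℤ) + 1)))) atTop (𝓝 0) := by
  have inv_pow_tendsto : Tendsto (fun J : ℕ => c * q * q⁻¹ ^ J) atTop atTop :=
    (tendsto_pow_atTop_atTop_of_one_lt ((one_lt_inv₀ hq0).2 hq1)).const_mul_atTop (mul_pos hc hq0)
  refine (Real.tendsto_exp_neg_atTop_nhds_zero.comp inv_pow_tendsto).congr fun J => ?_
  rw [Function.comp_apply, zpow_add₀ hq0.ne', zpow_neg, zpow_natCast, zpow_one, inv_pow,
    mul_assoc, mul_comm q]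

theorem tendsto_exp_neg_mul_zpow_add_one (hq0 : 0 < q) (hq1 : q < 1) (C : ℝ) :
    Tendsto (fun J : ℕ => Real.exp (-(C * q ^ ((J : ℤ) + 1)))) atTop (𝓝 1) := by
  have pow_tendsto := ((tendsto_pow_atTop_nhds_zero_of_lt_one hq0.le hq1).const_mul (C * q)).neg
  rw [mul_zero, neg_zero] at pow_tendsto
  rw [← Real.exp_zero]
  refine ((Real.continuous_exp.tendsto 0).comp pow_tendsto).congr fun J => ?_
  rw [Function.comp_apply, zpow_add₀ hq0.ne', zpow_natCast, zpow_one, mul_assoc, mul_comm q]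

end

namespace HasGumbelCDF

variable {q c C : ℝ} {B : ℕ → ℝ} {κ : ℕ → ℤ} {μ ν : ℕ → Measure ℤ}

theorem eventually_lt_real_Ioc [∀ n, IsFiniteMeasure (μ n)] (h : HasGumbelCDF q B κ μ)
    (hq0 : 0 < q) (hq1 : q < 1) (hc : 0 < c) (hB : ∀ᶠ n in atTop, B n ∈ Set.Icc c C) {ε : ℝ}
    (hε : 0 < ε) : ∀ᶠ J : ℕ in atTop, ∀ᶠ n in atTop,
      1 - ε < (μ n).real (Set.Ioc (κ n + -J) (κ n + J)) := by
  have δ_pos : 0 < ε / 4 := by positivity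
  filter_upwards [(tendsto_exp_neg_mul_zpow_neg_add_one hq0 hq1 hc).eventually_lt_const δ_pos,
    (tendsto_exp_neg_mul_zpow_add_one hq0 hq1 C).eventually_const_lt
      (show 1 - ε / 4 < 1 by linarith)] with J hcJ hCJ
  filter_upwards [hB, (h (-J)).eventually_lt_const δ_pos,
    (h J).eventually_const_lt (neg_lt_zero.2 δ_pos)] with n ⟨hcB, hBC⟩ lower upper
  have exp_lower :
      Real.exp (-(B n * q ^ (-(J : ℤ) + 1))) ≤ Real.exp (-(c * q ^ (-(J : ℤ) + 1))) := by gcongr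
  have exp_upper : Real.exp (-(C * q ^ ((J : ℤ) + 1))) ≤ Real.exp (-(B n * q ^ ((J : ℤ) + 1))) := by
    gcongr
  rw [real_Ioc_eq_sub _ (by lia)]
  linarith

theorem tendsto_singleton_sub [∀ n, IsFiniteMeasure (μ n)] [∀ n, IsFiniteMeasure (ν n)]
    (hμ : HasGumbelCDF q B κ μ) (hν : HasGumbelCDF q B κ ν) (j : ℤ) :
    Tendsto (fun n => (μ n).real {κ n + j} - (ν n).real {κ n + j}) atTop (𝓝 0) := by
  have cdf_diff := ((hμ j).sub (hμ (j - 1))).sub ((hν j).sub (hν (j - 1)))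
  simp only [sub_zero] at cdf_diff
  refine cdf_diff.congr fun n => ?_
  rw [real_singleton_int_eq_sub (μ n), real_singleton_int_eq_sub (ν n), ← add_sub_assoc]
  ring

theorem comp (h : HasGumbelCDF q B κ μ) {φ : ℕ → ℕ} (hφ : Tendsto φ atTop atTop) :
    HasGumbelCDF q (fun n => B (φ n)) (fun n => κ (φ n)) (fun n => μ (φ n)) :=
  fun j => (h j).comp hφ

theorem of_tendsto {b : ℝ} {L : Measure ℤ} (hB : Tendsto B atTop (𝓝 b))
    (hL : ∀ j : ℤ, L.real (Set.Iic j) = Real.exp (-(b * q ^ (j + 1)))) :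
    HasGumbelCDF q B 0 (fun _ => L) := by
  intro j
  have exp_tendsto : Tendsto (fun n => Real.exp (-(B n * q ^ (j + 1)))) atTop
      (𝓝 (Real.exp (-(b * q ^ (j + 1))))) :=
    (Real.continuous_exp.tendsto _).comp (hB.mul_const _).neg
  simpa [hL] using exp_tendsto.const_sub (Real.exp (-(b * q ^ (j + 1))))

/- At `j = -1` the distribution function is `exp (-B n)`, so weak convergence forces `B n` to
converge. -/
theorem exists_tendsto {P : ℕ → ProbabilityMeasure ℤ} {L : ProbabilityMeasure ℤ}
    (h : HasGumbelCDF q B 0 fun n => (P n : Measure ℤ)) (hL : Tendsto P atTop (𝓝 L))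
    (hB : ∀ᶠ n in atTop, B n ≤ C) : ∃ b, Tendsto B atTop (𝓝 b) := by
  have cdf_tendsto : Tendsto (fun n => (P n : Measure ℤ).real (Set.Iic (-1))) atTop
      (𝓝 ((L : Measure ℤ).real (Set.Iic (-1)))) :=
    (NNReal.continuous_coe.tendsto _).comp
      (ProbabilityMeasure.tendsto_measure_of_null_frontier_of_tendsto hL (by simp))
  have exp_tendsto := cdf_tendsto.sub (h (-1))
  simp only [Pi.zero_apply, zero_add, sub_sub_cancel, neg_add_cancel, zpow_zero, mul_one,
    sub_zero] at exp_tendsto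
  have le_limit : Real.exp (-C) ≤ (L : Measure ℤ).real (Set.Iic (-1)) := by
    refine ge_of_tendsto exp_tendsto ?_
    filter_upwards [hB] with n hn
    gcongr
  have neg_log_tendsto := (exp_tendsto.log ((Real.exp_pos _).trans_le le_limit).ne').neg
  simp only [Real.log_exp, neg_neg] at neg_log_tendsto
  exact ⟨_, neg_log_tendsto⟩

variable [∀ n, IsProbabilityMeasure (μ n)]

theorem dApprox [∀ n, IsProbabilityMeasure (ν n)] (hμ : HasGumbelCDF q B κ μ)
    (hν : HasGumbelCDF q B κ ν) (hq0 : 0 < q) (hq1 : q < 1) (hc : 0 < c)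
    (hB : ∀ᶠ n in atTop, B n ∈ Set.Icc c C) : DApprox μ ν := by
  refine tendsto_order.2 ⟨fun ε hε => Eventually.of_forall fun n =>
    hε.trans_le (tvDist_nonneg _ _), fun ε hε => ?_⟩
  have δ_pos : 0 < ε / 3 := by positivity
  obtain ⟨J, μ_window, ν_window⟩ := ((hμ.eventually_lt_real_Ioc hq0 hq1 hc hB δ_pos).and
    (hν.eventually_lt_real_Ioc hq0 hq1 hc hB δ_pos)).exists
  have sum_tendsto : Tendsto (fun n => ∑ j ∈ Finset.Ioc (-(J : ℤ)) J,
      |(μ n).real {κ n + j} - (ν n).real {κ n + j}|) atTop (𝓝 0) := by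
    simpa using tendsto_finsetSum (Finset.Ioc (-(J : ℤ)) J)
      fun j _ => (hμ.tendsto_singleton_sub hν j).abs
  filter_upwards [μ_window, ν_window, sum_tendsto.eventually_lt_const δ_pos]
    with n hμn hνn hsum
  have tvDist_le := tvDist_le (μ n) (ν n) (Finset.Ioc (κ n + -J) (κ n + J))
  rw [Finset.coe_Ioc, ← Finset.image_add_left_Ioc,
    Finset.sum_image (add_right_injective _).injOn] at tvDist_le
  linarith

theorem isTightMeasureSet (h : HasGumbelCDF q B 0 μ) (hq0 : 0 < q) (hq1 : q < 1) (hc : 0 < c)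
    (hB : ∀ᶠ n in atTop, B n ∈ Set.Icc c C) : IsTightMeasureSet (Set.range μ) := by
  refine isTightMeasureSet_range_of_tendsto_limsup_measure_norm_gt
    (ENNReal.tendsto_nhds_zero.2 fun ε hε => ?_)
  obtain ⟨δ, δ_pos, δ_lt⟩ := ENNReal.lt_iff_exists_nnreal_btwn.1 hε
  obtain ⟨J, window⟩ := (h.eventually_lt_real_Ioc hq0 hq1 hc hB
    (NNReal.coe_pos.2 (ENNReal.coe_pos.1 δ_pos))).exists
  filter_upwards [eventually_ge_atTop (J : ℝ)] with r hr
  refine limsup_le_of_le (h := ?_)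
  filter_upwards [window] with n hn
  simp only [Pi.zero_apply, zero_add] at hn
  have subset_compl : {x : ℤ | r < ‖x‖} ⊆ (Set.Ioc (-(J : ℤ)) J)ᶜ := by
    intro x (hx : r < ‖x‖) hmem
    have abs_le : |x| ≤ J := abs_le.2 ⟨hmem.1.le, hmem.2⟩
    rw [Int.norm_eq_abs] at hx
    have : |(x : ℝ)| ≤ J := mod_cast abs_le
    linarith
  have compl_le : (μ n).real (Set.Ioc (-(J : ℤ)) J)ᶜ ≤ δ := by
    rw [probReal_compl_eq_one_sub measurableSet_Ioc]
    linarith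
  calc μ n {x | r < ‖x‖} ≤ μ n (Set.Ioc (-(J : ℤ)) J)ᶜ := measure_mono subset_compl
    _ ≤ δ := by
      rwa [← ENNReal.ofReal_coe_nnreal, ENNReal.le_ofReal_iff_toReal_le (measure_ne_top _ _)
        δ.coe_nonneg]
    _ ≤ ε := δ_lt.le

end HasGumbelCDF

/-! ### The Gumbel distribution and maxima of geometric variables -/

theorem gumbel_real_Iio (x : ℝ) : gumbel.real (Set.Iio x) = Real.exp (-Real.exp (-x)) := by
  have continuous_cdf : Continuous fun x : ℝ => Real.exp (-Real.exp (-x)) := by fun_prop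
  have leftLim_eq : Function.leftLim gumbelCDF x = gumbelCDF x :=
    leftLim_eq_of_tendsto ((continuous_cdf.tendsto x).mono_left nhdsWithin_le_nhds)
  rw [measureReal_def, gumbel, gumbelCDF.measure_Iio tendsto_gumbelCDF_atBot, leftLim_eq, sub_zero]
  exact ENNReal.toReal_ofReal (Real.exp_pos _).le

theorem gumbel_map_floor_real_Iic {q B : ℝ} (hq0 : 0 < q) (hq1 : q < 1) (hB : 0 < B) (j : ℤ) :
    (gumbel.map fun x => ⌊(x + Real.log B) / Real.log (1 / q)⌋).real (Set.Iic j) =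
      Real.exp (-(B * q ^ (j + 1))) := by
  have log_pos : 0 < Real.log (1 / q) := Real.log_pos ((one_lt_div hq0).2 hq1)
  have preimage_eq : (fun x : ℝ => ⌊(x + Real.log B) / Real.log (1 / q)⌋) ⁻¹' Set.Iic j =
      Set.Iio ((j + 1 : ℤ) * Real.log (1 / q) - Real.log B) := by
    ext x
    rw [Set.mem_preimage, Set.mem_Iic, Set.mem_Iio, ← Int.lt_add_one_iff, Int.floor_lt,
      div_lt_iff₀ log_pos, lt_sub_iff_add_lt]
  rw [map_measureReal_apply (by fun_prop) measurableSet_Iic, preimage_eq, gumbel_real_Iio,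
    neg_sub, Real.exp_sub, Real.exp_log hB, one_div, Real.log_inv, mul_neg, Real.exp_neg (_ * _),
    div_inv_eq_mul, ← Real.log_zpow, Real.exp_log (zpow_pos hq0 _)]

instance isProbabilityMeasure_gumbel_map_floor_add_div (s l : ℝ) :
    IsProbabilityMeasure (gumbel.map fun x => ⌊(x + s) / l⌋) :=
  Measure.isProbabilityMeasure_map (by fun_prop)

instance isProbabilityMeasure_gumbel_map_floor_div_add (s l : ℝ) :
    IsProbabilityMeasure (gumbel.map fun x => ⌊x / l + s⌋) :=
  Measure.isProbabilityMeasure_map (by fun_prop)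

theorem geometricMeasure_real_Iic {p : unitInterval} (hp : p ≠ 0) (K : ℕ) :
    (geometricMeasure p).real (Set.Iic K) = 1 - (1 - p : ℝ) ^ (K + 1) := by
  have Iic_eq : Set.Iic K = (Finset.range (K + 1) : Finset ℕ) := by
    ext x
    simp
  have geom_sum := geom_sum_mul_neg (1 - p : ℝ) (K + 1)
  rw [sub_sub_cancel] at geom_sum
  rw [Iic_eq, ← sum_measureReal_singleton, ← geom_sum, Finset.sum_mul]
  exact Finset.sum_congr rfl fun k _ => geometricMeasure_real_singleton hp k

instance isProbabilityMeasure_maxGeometric (p : unitInterval) (N : ℕ) :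
    IsProbabilityMeasure (maxGeometric p N) :=
  Measure.isProbabilityMeasure_map (Measurable.of_discrete (α := Fin N → ℕ)).aemeasurable

theorem maxGeometric_real_Iic {p : unitInterval} (hp : p ≠ 0) (N K : ℕ) :
    (maxGeometric p N).real (Set.Iic (K : ℤ)) = (1 - (1 - p : ℝ) ^ (K + 1)) ^ N := by
  have preimage_eq : (fun x : Fin N → ℕ => ((Finset.univ.sup x : ℕ) : ℤ)) ⁻¹' Set.Iic (K : ℤ) =
      Set.pi Set.univ fun _ => Set.Iic K := by
    ext x
    simp [Pi.le_def]
  rw [maxGeometric, map_measureReal_apply .of_discrete measurableSet_Iic, preimage_eq,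
    measureReal_def, Measure.pi_pi, ENNReal.toReal_prod]
  simp only [← measureReal_def, geometricMeasure_real_Iic hp, Finset.prod_const, Finset.card_univ,
    Fintype.card_fin]

/-! ### Sequences with geometric ratios -/

theorem isBigO_natCast_sub_one_iff {k l : ℕ → ℕ} :
    (fun n => (k n : ℝ) - (l n : ℝ)) =O[atTop] (fun _ => (1 : ℝ)) ↔
      ∃ D, ∀ᶠ n in atTop, k n ≤ l n + D ∧ l n ≤ k n + D := by
  rw [isBigO_one_iff, IsBoundedUnder, IsBounded]
  simp only [eventually_map, Real.norm_eq_abs]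
  constructor
  · rintro ⟨C, hC⟩
    refine ⟨⌈C⌉₊, hC.mono fun n hn => ?_⟩
    obtain ⟨lower, upper⟩ := abs_le.1 (hn.trans (Nat.le_ceil C))
    constructor <;> rw [← Nat.cast_le (α := ℝ), Nat.cast_add] <;> linarith
  · rintro ⟨D, hD⟩
    refine ⟨D, hD.mono fun n hn => ?_⟩
    rw [← Nat.cast_le (α := ℝ), ← Nat.cast_le (α := ℝ), Nat.cast_add, Nat.cast_add] at hn
    rw [abs_le]
    constructor <;> linarith

theorem isTheta_natCast_mul_one {f : ℕ → ℝ} (h : f =Θ[atTop] (fun n : ℕ => 1 / (n : ℝ))) :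
    (fun n : ℕ => n * f n) =Θ[atTop] (fun _ => (1 : ℝ)) := by
  refine ((isTheta_refl (fun n : ℕ => (n : ℝ)) atTop).mul h).trans_eventuallyEq ?_
  filter_upwards [eventually_gt_atTop 0] with n hn
  exact mul_one_div_cancel (Nat.cast_ne_zero.2 hn.ne')

theorem exists_eventually_mem_Icc_of_isTheta_one {f : ℕ → ℝ}
    (h : f =Θ[atTop] (fun _ => (1 : ℝ))) (hf : ∀ n, 0 ≤ f n) :
    ∃ c > 0, ∃ C, ∀ᶠ n in atTop, f n ∈ Set.Icc c C := by
  obtain ⟨C, -, hC⟩ := h.1.exists_pos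
  obtain ⟨c, hc, hc'⟩ := h.2.exists_pos
  refine ⟨c⁻¹, inv_pos.2 hc, C, ?_⟩
  filter_upwards [hC.bound, hc'.bound] with n upper lower
  rw [norm_one, Real.norm_of_nonneg (hf n)] at upper lower
  exact ⟨(inv_le_iff_one_le_mul₀' hc).2 lower, by rwa [mul_one] at upper⟩

/-- Nonnegative sequences whose ratios of consecutive terms converge to some `q ∈ (0, 1)`: the
class of distributions with asymptotically geometric tails. As `x / 0 = 0`, the positivity of `q`
makes the terms eventually positive. -/
structure GeomRatio (p : ℕ → ℝ) (q : ℝ) : Prop where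
  nonneg : ∀ k, 0 ≤ p k
  q_pos : 0 < q
  q_lt_one : q < 1
  ratio : Tendsto (fun k => p (k + 1) / p k) atTop (𝓝 q)

namespace GeomRatio

variable {p : ℕ → ℝ} {q : ℝ}

theorem eventually_pos (h : GeomRatio p q) : ∀ᶠ k in atTop, 0 < p k := by
  filter_upwards [h.ratio.eventually_const_lt h.q_pos] with k hk
  refine (h.nonneg k).lt_of_ne' fun p_eq => ?_
  rw [p_eq, div_zero] at hk
  exact hk.false

theorem eventually_add_le_pow_mul (h : GeomRatio p q) {r : ℝ} (hr : q < r) :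
    ∀ᶠ k in atTop, ∀ i, p (k + i) ≤ r ^ i * p k := by
  obtain ⟨k₀, hk₀⟩ := eventually_atTop.1 (h.eventually_pos.and (h.ratio.eventually_lt_const hr))
  filter_upwards [eventually_ge_atTop k₀] with k hk i
  induction i with
  | zero => simp
  | succ i ih =>
    obtain ⟨p_pos, ratio_lt⟩ := hk₀ (k + i) (by lia)
    have r_pos : 0 < r := h.q_pos.trans hr
    calc p (k + (i + 1)) ≤ r * p (k + i) := ((div_lt_iff₀ p_pos).1 ratio_lt).le
      _ ≤ r * (r ^ i * p k) := by gcongr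
      _ = r ^ (i + 1) * p k := by ring

theorem eventually_pow_mul_le_add (h : GeomRatio p q) {s : ℝ} (hs0 : 0 ≤ s) (hs : s < q) :
    ∀ᶠ k in atTop, ∀ i, s ^ i * p k ≤ p (k + i) := by
  obtain ⟨k₀, hk₀⟩ := eventually_atTop.1 (h.eventually_pos.and (h.ratio.eventually_const_lt hs))
  filter_upwards [eventually_ge_atTop k₀] with k hk i
  induction i with
  | zero => simp
  | succ i ih =>
    obtain ⟨p_pos, lt_ratio⟩ := hk₀ (k + i) (by lia)
    calc s ^ (i + 1) * p k = s * (s ^ i * p k) := by ring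
      _ ≤ s * p (k + i) := by gcongr
      _ ≤ p (k + (i + 1)) := ((lt_div_iff₀ p_pos).1 lt_ratio).le

theorem eventually_antitone (h : GeomRatio p q) :
    ∀ᶠ k in atTop, ∀ l, k ≤ l → p l ≤ p k := by
  filter_upwards [h.eventually_add_le_pow_mul h.q_lt_one] with k hk l hkl
  obtain ⟨i, rfl⟩ := Nat.exists_eq_add_of_le hkl
  simpa using hk i

theorem tendsto_add_div (h : GeomRatio p q) (i : ℕ) :
    Tendsto (fun k => p (k + i) / p k) atTop (𝓝 (q ^ i)) := by
  induction i with
  | zero =>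
    refine tendsto_const_nhds.congr' ?_
    filter_upwards [h.eventually_pos] with k hk
    rw [add_zero, div_self hk.ne', pow_zero]
  | succ i ih =>
    rw [pow_succ']
    refine ((h.ratio.comp (tendsto_add_atTop_nat i)).mul ih).congr' ?_
    filter_upwards [(tendsto_add_atTop_nat i).eventually h.eventually_pos] with k hk
    exact div_mul_div_cancel₀ hk.ne'

theorem tendsto_toNat_add_div (h : GeomRatio p q) {k : ℕ → ℕ} (hk : Tendsto k atTop atTop)
    (j : ℤ) : Tendsto (fun n => p ((k n + j).toNat) / p (k n)) atTop (𝓝 (q ^ j)) := by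
  obtain ⟨i, rfl | rfl⟩ := j.eq_nat_or_neg
  · rw [zpow_natCast]
    exact (h.tendsto_add_div i).comp hk
  · rw [zpow_neg, zpow_natCast]
    have sub_tendsto : Tendsto (fun n => k n - i) atTop atTop := (tendsto_sub_atTop_nat i).comp hk
    refine (((h.tendsto_add_div i).inv₀ (pow_ne_zero _ h.q_pos.ne')).comp sub_tendsto).congr' ?_
    filter_upwards [hk.eventually_ge_atTop i] with n hn
    have toNat_eq : ((k n : ℤ) + -(i : ℤ)).toNat = k n - i := by lia
    rw [Function.comp_apply, inv_div, toNat_eq, Nat.sub_add_cancel hn]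

theorem summable (h : GeomRatio p q) : Summable p := by
  refine summable_of_ratio_test_tendsto_lt_one h.q_lt_one
    (h.eventually_pos.mono fun k hk => hk.ne') (h.ratio.congr fun k => ?_)
  rw [Real.norm_of_nonneg (h.nonneg _), Real.norm_of_nonneg (h.nonneg _)]

theorem tendsto_tailSum_div (h : GeomRatio p q) :
    Tendsto (fun K => tailSum p K / p K) atTop (𝓝 (q / (1 - q))) := by
  obtain ⟨r, hqr, hr1⟩ := exists_between h.q_lt_one
  have hr0 := h.q_pos.trans hqr
  have limit_eq : q / (1 - q) = ∑' i : ℕ, q ^ (i + 1) := by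
    simp_rw [pow_succ']
    rw [tsum_mul_left, tsum_geometric_of_lt_one h.q_pos.le h.q_lt_one, div_eq_mul_inv]
  rw [limit_eq]
  simp_rw [tailSum, ← tsum_div_const]
  refine tendsto_tsum_of_dominated_convergence (bound := fun i => r ^ (i + 1))
    ((summable_geometric_of_lt_one hr0.le hr1).comp_injective (add_left_injective 1)) ?_ ?_
  · intro i
    refine (h.tendsto_add_div (i + 1)).congr fun K => ?_
    rw [add_comm K, add_right_comm, add_assoc]
  · filter_upwards [h.eventually_pos, h.eventually_add_le_pow_mul hqr] with K p_pos add_le i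
    rw [Real.norm_of_nonneg (div_nonneg (h.nonneg _) p_pos.le), div_le_iff₀ p_pos, add_comm K,
      ← add_assoc, add_comm (i + 1)]
    exact add_le (i + 1)

section Comparison

variable {k l : ℕ → ℕ}

theorem isBigO_comp_of_le_add (h : GeomRatio p q) (hk : Tendsto k atTop atTop)
    (hl : Tendsto l atTop atTop) {D : ℕ} (hD : ∀ᶠ n in atTop, l n ≤ k n + D) :
    (fun n => p (k n)) =O[atTop] (fun n => p (l n)) := by
  have s_pos := half_pos h.q_pos
  refine IsBigO.of_bound ((q / 2) ^ D)⁻¹ ?_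
  filter_upwards [hD, hk.eventually (h.eventually_pow_mul_le_add s_pos.le (half_lt_self h.q_pos)),
    hl.eventually h.eventually_antitone] with n hn pow_mul_le antitone
  rw [Real.norm_of_nonneg (h.nonneg _), Real.norm_of_nonneg (h.nonneg _),
    le_inv_mul_iff₀ (pow_pos s_pos D)]
  exact (pow_mul_le D).trans (antitone _ hn)

theorem exists_eventually_le_add (h : GeomRatio p q) (hk : Tendsto k atTop atTop)
    (hO : (fun n => p (k n)) =O[atTop] (fun n => p (l n))) :
    ∃ D, ∀ᶠ n in atTop, l n ≤ k n + D := by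
  obtain ⟨r, hqr, hr1⟩ := exists_between h.q_lt_one
  obtain ⟨C, C_pos, hC⟩ := hO.exists_pos
  obtain ⟨D, hD⟩ := exists_pow_lt_of_lt_one (inv_pos.2 C_pos) hr1
  have C_mul_lt_one : C * r ^ D < 1 := by
    simpa only [mul_inv_cancel₀ C_pos.ne'] using mul_lt_mul_of_pos_left hD C_pos
  have shift_tendsto : Tendsto (fun n => k n + D) atTop atTop :=
    (tendsto_add_atTop_nat D).comp hk
  refine ⟨D, ?_⟩
  filter_upwards [hC.bound, hk.eventually h.eventually_pos,
    hk.eventually (h.eventually_add_le_pow_mul hqr),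
    shift_tendsto.eventually h.eventually_antitone] with n hn p_pos add_le antitone
  rw [Real.norm_of_nonneg (h.nonneg _), Real.norm_of_nonneg (h.nonneg _)] at hn
  by_contra! l_gt
  have : p (k n) < p (k n) := calc
    p (k n) ≤ C * p (l n) := hn
    _ ≤ C * (r ^ D * p (k n)) := by gcongr; exact (antitone _ l_gt.le).trans (add_le D)
    _ = C * r ^ D * p (k n) := by ring
    _ < p (k n) := mul_lt_of_lt_one_left p_pos C_mul_lt_one
  exact this.false

theorem isTheta_comp_iff (h : GeomRatio p q) (hk : Tendsto k atTop atTop)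
    (hl : Tendsto l atTop atTop) :
    (fun n => p (k n)) =Θ[atTop] (fun n => p (l n)) ↔
      (fun n => (k n : ℝ) - (l n : ℝ)) =O[atTop] (fun _ => (1 : ℝ)) := by
  rw [isBigO_natCast_sub_one_iff]
  constructor
  · rintro ⟨hO, hO'⟩
    obtain ⟨D, hD⟩ := h.exists_eventually_le_add hk hO
    obtain ⟨D', hD'⟩ := h.exists_eventually_le_add hl hO'
    refine ⟨D + D', ?_⟩
    filter_upwards [hD, hD'] with n hn hn'
    lia
  · rintro ⟨D, hD⟩
    exact ⟨h.isBigO_comp_of_le_add hk hl (hD.mono fun _ hn => hn.2),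
      h.isBigO_comp_of_le_add hl hk (hD.mono fun _ hn => hn.1)⟩

theorem tendsto_atTop_of_isTheta (h : GeomRatio p q)
    (hk : (fun n => p (k n)) =Θ[atTop] (fun n : ℕ => 1 / (n : ℝ))) : Tendsto k atTop atTop := by
  have tendsto_zero : Tendsto (fun n => p (k n)) atTop (𝓝 0) :=
    hk.1.trans_tendsto tendsto_one_div_atTop_nhds_zero_nat
  suffices Tendsto k atTop cofinite by rwa [Nat.cofinite_eq_atTop] at this
  refine le_cofinite_iff_eventually_ne.2 fun i => eventually_map.2 ?_
  rcases (h.nonneg i).eq_or_lt' with p_eq | p_pos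
  · filter_upwards [hk.2.eq_zero_imp, eventually_gt_atTop 0] with n imp n_pos k_eq
    exact (one_div_pos.2 (Nat.cast_pos.2 n_pos)).ne' (imp (k_eq ▸ p_eq))
  · filter_upwards [tendsto_zero.eventually_lt_const p_pos] with n p_lt k_eq
    exact p_lt.ne (k_eq ▸ rfl)

theorem eventually_le_of_tendsto_div (h : GeomRatio p q) (hk : Tendsto k atTop atTop)
    (hkl : Tendsto (fun n => p (l n) / p (k n)) atTop (𝓝 1)) : ∀ᶠ n in atTop, l n ≤ k n := by
  obtain ⟨r, hqr, hr1⟩ := exists_between h.q_lt_one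
  filter_upwards [hkl.eventually_const_lt hr1, hk.eventually h.eventually_pos,
    hk.eventually (h.eventually_add_le_pow_mul hqr),
    ((tendsto_add_atTop_nat 1).comp hk).eventually h.eventually_antitone]
    with n r_lt p_pos add_le antitone
  by_contra! k_lt
  rw [lt_div_iff₀ p_pos] at r_lt
  refine (r_lt.trans_le (antitone _ k_lt)).not_ge ?_
  simpa using add_le 1

theorem not_tendsto_natCast_mul_comp (h : GeomRatio p q) (hk : Tendsto k atTop atTop) {b : ℝ}
    (hb : 0 < b) : ¬ Tendsto (fun n : ℕ => n * p (k n)) atTop (𝓝 b) := by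
  intro lim
  have succ_tendsto : Tendsto (fun n => k (n + 1)) atTop atTop :=
    hk.comp (tendsto_add_atTop_nat 1)
  have ratio_tendsto : Tendsto (fun n => p (k (n + 1)) / p (k n)) atTop (𝓝 1) := by
    have := ((lim.comp (tendsto_add_atTop_nat 1)).div lim hb.ne').mul
      (tendsto_natCast_div_add_atTop (1 : ℝ))
    rw [div_self hb.ne', mul_one] at this
    refine this.congr' ?_
    filter_upwards [eventually_gt_atTop 0] with n hn
    have : (0 : ℝ) < n := Nat.cast_pos.2 hn
    simp only [Function.comp_apply, Pi.div_apply, Nat.cast_add, Nat.cast_one]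
    field_simp
  have inv_tendsto : Tendsto (fun n => p (k n) / p (k (n + 1))) atTop (𝓝 1) := by
    simpa only [inv_div, inv_one] using ratio_tendsto.inv₀ one_ne_zero
  have eventually_const : EventuallyConst k atTop := by
    rw [eventuallyConst_atTop_nat]
    refine eventually_atTop.1 ?_
    filter_upwards [h.eventually_le_of_tendsto_div hk ratio_tendsto,
      h.eventually_le_of_tendsto_div succ_tendsto inv_tendsto] with n hn hn'
    exact hn.antisymm hn'
  obtain ⟨K, hK⟩ := eventuallyConst_iff_exists_eventuallyEq.1 eventually_const
  obtain ⟨n, n_eq, n_gt⟩ := (hK.and (hk.eventually_gt_atTop K)).exists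
  exact n_gt.ne' n_eq

end Comparison

section CriticalIndex

variable (h : GeomRatio p q)
include h

theorem bddAbove_setOf_le {x : ℝ} (hx : 0 < x) : BddAbove {k | x ≤ p k} := by
  obtain ⟨K, hK⟩ := eventually_atTop.1
    (h.summable.tendsto_atTop_zero.eventually_lt_const hx)
  refine ⟨K, fun k hk => ?_⟩
  by_contra! K_lt
  exact (hK k K_lt.le).not_ge hk

theorem le_sSup_setOf_le {x : ℝ} (hx : 0 < x) {i : ℕ} (hi : x ≤ p i) :
    i ≤ sSup {k | x ≤ p k} := le_csSup (h.bddAbove_setOf_le hx) hi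

theorem tendsto_sSup :
    Tendsto (fun n : ℕ => sSup {k | 1 / (n : ℝ) ≤ p k}) atTop atTop := by
  refine tendsto_atTop.2 fun b => ?_
  obtain ⟨i, p_pos, b_le⟩ := (h.eventually_pos.and (eventually_ge_atTop b)).exists
  filter_upwards [tendsto_one_div_atTop_nhds_zero_nat.eventually_lt_const p_pos,
    eventually_gt_atTop 0] with n hn n_pos
  exact b_le.trans (h.le_sSup_setOf_le (by positivity) hn.le)

theorem isTheta_sSup :
    (fun n : ℕ => p (sSup {k | 1 / (n : ℝ) ≤ p k})) =Θ[atTop] (fun n : ℕ => 1 / (n : ℝ)) := by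
  have s_pos := half_pos h.q_pos
  constructor
  · refine IsBigO.of_bound (q / 2)⁻¹ ?_
    filter_upwards [eventually_gt_atTop 0,
      h.tendsto_sSup.eventually (h.eventually_pow_mul_le_add s_pos.le (half_lt_self h.q_pos))]
      with n n_pos pow_mul_le
    have inv_pos : 0 < 1 / (n : ℝ) := by positivity
    rw [Real.norm_of_nonneg (h.nonneg _), Real.norm_of_nonneg inv_pos.le, le_inv_mul_iff₀ s_pos]
    have succ_lt : p (sSup {k | 1 / (n : ℝ) ≤ p k} + 1) < 1 / n := by
      by_contra! le_succ
      exact (Nat.lt_succ_self _).not_ge (h.le_sSup_setOf_le inv_pos le_succ)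
    simpa only [pow_one] using (pow_mul_le 1).trans succ_lt.le
  · obtain ⟨i, p_pos⟩ := h.eventually_pos.exists
    refine IsBigO.of_bound 1 ?_
    filter_upwards [tendsto_one_div_atTop_nhds_zero_nat.eventually_lt_const p_pos,
      eventually_gt_atTop 0] with n hn n_pos
    have inv_pos : 0 < 1 / (n : ℝ) := by positivity
    rw [one_mul, Real.norm_of_nonneg (h.nonneg _), Real.norm_of_nonneg inv_pos.le]
    exact Nat.sSup_mem (s := {k | 1 / (n : ℝ) ≤ p k}) ⟨i, hn.le⟩ (h.bddAbove_setOf_le inv_pos)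

theorem isTheta_iff_sub_sSup_isBigO (k : ℕ → ℕ) :
    (fun n => p (k n)) =Θ[atTop] (fun n : ℕ => 1 / (n : ℝ)) ↔
      (fun n : ℕ => (k n : ℝ) - (sSup {k | 1 / (n : ℝ) ≤ p k} : ℕ)) =O[atTop]
        (fun _ => (1 : ℝ)) := by
  constructor
  · intro hk
    exact (h.isTheta_comp_iff (h.tendsto_atTop_of_isTheta hk) h.tendsto_sSup).1
      (hk.trans h.isTheta_sSup.symm)
  · intro hO
    obtain ⟨D, hD⟩ := isBigO_natCast_sub_one_iff.1 hO
    have hk : Tendsto k atTop atTop :=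
      tendsto_atTop_mono' _ (hD.mono fun _ hn => Nat.sub_le_of_le_add hn.2)
        ((tendsto_sub_atTop_nat D).comp h.tendsto_sSup)
    exact ((h.isTheta_comp_iff hk h.tendsto_sSup).2 hO).trans h.isTheta_sSup

end CriticalIndex

end GeomRatio

/-! ### Comparison laws -/

theorem tendsto_exp_neg_sub_exp_neg {x y : ℕ → ℝ} (hy : ∀ᶠ n in atTop, 0 ≤ y n)
    (h : Tendsto (fun n => x n - y n) atTop (𝓝 0)) :
    Tendsto (fun n => Real.exp (-x n) - Real.exp (-y n)) atTop (𝓝 0) := by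
  have exp_bounded : IsBoundedUnder (· ≤ ·) atTop (norm ∘ fun n => Real.exp (-y n)) := by
    refine isBoundedUnder_of_eventually_le (a := 1) (hy.mono fun n hn => ?_)
    rw [Function.comp_apply, Real.norm_of_nonneg (Real.exp_pos _).le]
    exact Real.exp_le_one_iff.2 (neg_nonpos.2 hn)
  have exp_sub_one : Tendsto (fun n => Real.exp (-(x n - y n)) - 1) atTop (𝓝 0) := by
    simpa using ((Real.continuous_exp.tendsto _).comp h.neg).sub_const 1
  refine (isBoundedUnder_le_mul_tendsto_zero exp_bounded exp_sub_one).congr fun n => ?_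
  rw [mul_sub, ← Real.exp_add, mul_one, neg_sub, add_sub, neg_add_cancel, zero_sub]

theorem tendsto_one_sub_pow_sub_exp {x : ℕ → ℝ} {N : ℕ → ℕ} (hx : Tendsto x atTop (𝓝 0))
    (hx0 : ∀ n, 0 ≤ x n) (hNx : (fun n => N n * x n) =O[atTop] fun _ => (1 : ℝ)) :
    Tendsto (fun n => (1 - x n) ^ N n - Real.exp (-(N n * x n))) atTop (𝓝 0) := by
  have log_isLittleO : (fun y : ℝ => Real.log (1 - y) + y) =o[𝓝 0] fun y => y := by
    have deriv_log : HasDerivAt (fun y : ℝ => Real.log (1 - y)) (-1) 0 := by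
      simpa using ((hasDerivAt_id (0 : ℝ)).const_sub 1).log (by simp)
    simpa using hasDerivAt_iff_isLittleO.1 deriv_log
  have mul_log_tendsto :
      Tendsto (fun n => -(N n * Real.log (1 - x n)) - N n * x n) atTop (𝓝 0) := by
    have := (isLittleO_one_iff ℝ).1 (((isBigO_refl (fun n => (N n : ℝ)) atTop).mul_isLittleO
      (log_isLittleO.comp_tendsto hx)).trans_isBigO hNx)
    rw [← neg_zero]
    refine this.neg.congr fun n => ?_
    rw [Function.comp_apply, mul_add, neg_add']
  refine (tendsto_exp_neg_sub_exp_neg (.of_forall fun n =>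
    mul_nonneg (Nat.cast_nonneg _) (hx0 n)) mul_log_tendsto).congr' ?_
  filter_upwards [hx.eventually_lt_const one_pos] with n hn
  rw [neg_neg, Real.exp_nat_mul, Real.exp_log (sub_pos.2 hn)]

theorem tendsto_toNat_add {k : ℕ → ℕ} (hk : Tendsto k atTop atTop) (j : ℤ) :
    Tendsto (fun n => (k n + j).toNat) atTop atTop :=
  tendsto_atTop_mono (fun n => by lia) ((tendsto_sub_atTop_nat j.natAbs).comp hk)

section

variable {q : ℝ} {B : ℕ → ℝ} {k : ℕ → ℕ}

theorem HasGumbelCDF.of_tendsto_sub {b : ℕ → ℝ} {κ : ℕ → ℤ} {μ : ℕ → Measure ℤ}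
    (h : HasGumbelCDF q b κ μ) (hq : 0 ≤ q) (hB : ∀ᶠ n in atTop, 0 ≤ B n)
    (hbB : Tendsto (fun n => b n - B n) atTop (𝓝 0)) : HasGumbelCDF q B κ μ := by
  intro j
  have mul_tendsto : Tendsto (fun n => b n * q ^ (j + 1) - B n * q ^ (j + 1)) atTop (𝓝 0) := by
    simpa only [sub_mul, zero_mul] using hbB.mul_const (q ^ (j + 1))
  simpa using (h j).add (tendsto_exp_neg_sub_exp_neg
    (hB.mono fun n hn => mul_nonneg hn (zpow_nonneg hq _)) mul_tendsto)

theorem HasGumbelCDF.map_sub {P : ℕ → PMF ℤ}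
    (h : HasGumbelCDF q B (fun n => k n) fun n => (P n).toMeasure) :
    HasGumbelCDF q B 0 fun n => ((P n).map fun y => y - (k n : ℤ)).toMeasure := by
  intro j
  refine (h j).congr fun n => ?_
  have preimage_eq : (fun y : ℤ => y - (k n : ℤ)) ⁻¹' Set.Iic (0 + j) = Set.Iic (k n + j) := by
    ext y
    simp only [Set.mem_preimage, Set.mem_Iic]
    lia
  beta_reduce
  rw [← PMF.toMeasure_map _ (P n) (Measurable.of_discrete (f := fun y : ℤ => y - (k n : ℤ))),
    map_measureReal_apply .of_discrete measurableSet_Iic, Pi.zero_apply, preimage_eq]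

theorem hasGumbelCDF_gumbel_log (hq0 : 0 < q) (hq1 : q < 1) (hB : ∀ᶠ n in atTop, 0 < B n) :
    HasGumbelCDF q B 0
      (fun n => gumbel.map fun x => ⌊(x + Real.log (B n)) / Real.log (1 / q)⌋) := by
  intro j
  refine tendsto_const_nhds.congr' (hB.mono fun n hn => ?_)
  beta_reduce
  rw [Pi.zero_apply, zero_add, gumbel_map_floor_real_Iic hq0 hq1 hn, sub_self]

theorem hasGumbelCDF_gumbel_logb (hq0 : 0 < q) (hq1 : q < 1) {N : ℕ → ℕ}
    (hN : ∀ᶠ n in atTop, 0 < N n) :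
    HasGumbelCDF q (fun n => N n * q ^ k n) (fun n => k n)
      (fun n => gumbel.map fun x => ⌊x / Real.log (1 / q) + Real.logb (1 / q) (N n)⌋) := by
  intro j
  refine tendsto_const_nhds.congr' (hN.mono fun n hn => ?_)
  simp_rw [Real.logb, ← add_div]
  rw [gumbel_map_floor_real_Iic hq0 hq1 (Nat.cast_pos.2 hn), mul_assoc, ← zpow_natCast,
    ← zpow_add₀ hq0.ne', add_assoc, sub_self]

theorem hasGumbelCDF_maxGeometric {r : unitInterval} (hr0 : 0 < (r : ℝ)) (hr1 : (r : ℝ) < 1)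
    (hk : Tendsto k atTop atTop) {N : ℕ → ℕ}
    (hN : (fun n => N n * (r : ℝ) ^ k n) =O[atTop] fun _ => (1 : ℝ)) :
    HasGumbelCDF r (fun n => N n * (r : ℝ) ^ k n) (fun n => k n)
      (fun n => maxGeometric (unitInterval.symm r) (N n)) := by
  intro j
  have symm_ne_zero : unitInterval.symm r ≠ 0 := by
    rw [Ne, unitInterval.symm_eq_zero, ← Subtype.coe_inj]
    exact hr1.ne
  have pow_tendsto : Tendsto (fun n => (r : ℝ) ^ ((k n + j).toNat + 1)) atTop (𝓝 0) :=
    (tendsto_pow_atTop_nhds_zero_of_lt_one hr0.le hr1).comp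
      ((tendsto_add_atTop_nat 1).comp (tendsto_toNat_add hk j))
  have toNat_eq : ∀ᶠ n in atTop, ((k n + j).toNat : ℤ) = k n + j :=
    (hk.eventually_ge_atTop j.natAbs).mono fun n hn => by lia
  have mul_pow_eq : ∀ᶠ n in atTop, N n * (r : ℝ) ^ ((k n + j).toNat + 1) =
      N n * (r : ℝ) ^ k n * (r : ℝ) ^ (j + 1) := toNat_eq.mono fun n hn => by
    rw [mul_assoc, ← zpow_natCast _ (k n), ← zpow_add₀ hr0.ne', ← zpow_natCast, Nat.cast_add, hn,
      Nat.cast_one, add_assoc]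
  have mul_pow_isBigO : (fun n => N n * (r : ℝ) ^ ((k n + j).toNat + 1)) =O[atTop]
      fun _ => (1 : ℝ) := by
    refine (isBigO_congr mul_pow_eq .rfl).2 ?_
    simpa only [mul_one] using hN.mul (isBigO_const_const ((r : ℝ) ^ (j + 1)) one_ne_zero atTop)
  refine (tendsto_one_sub_pow_sub_exp pow_tendsto (fun n => by positivity)
    mul_pow_isBigO).congr' ?_
  filter_upwards [toNat_eq, mul_pow_eq] with n hn mul_pow_eq
  obtain ⟨l, l_eq⟩ : ∃ l : ℕ, (k n + j : ℤ) = l := ⟨_, hn.symm⟩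
  rw [← mul_pow_eq, l_eq, maxGeometric_real_Iic symm_ne_zero, unitInterval.coe_symm_eq,
    sub_sub_cancel, Int.toNat_natCast]

end

section

variable {p : ℕ → ℝ} {q : ℝ} {k : ℕ → ℕ} (h : GeomRatio p q)
  (hk : (fun n => p (k n)) =Θ[atTop] (fun n : ℕ => 1 / (n : ℝ)))

include h hk in
theorem GeomRatio.exists_eventually_mem_Icc :
    ∃ c > 0, ∃ C, ∀ᶠ n : ℕ in atTop, n * p (k n) / (1 - q) ∈ Set.Icc c C := by
  obtain ⟨c, c_pos, C, hC⟩ := exists_eventually_mem_Icc_of_isTheta_one (isTheta_natCast_mul_one hk)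
    fun n => mul_nonneg n.cast_nonneg (h.nonneg _)
  have sub_pos : 0 < 1 - q := sub_pos.2 h.q_lt_one
  refine ⟨c / (1 - q), div_pos c_pos sub_pos, C / (1 - q), hC.mono fun n hn => ?_⟩
  exact ⟨div_le_div_of_nonneg_right hn.1 sub_pos.le, div_le_div_of_nonneg_right hn.2 sub_pos.le⟩

include hk in
theorem isBigO_natCast_mul_div_sub :
    (fun n : ℕ => n * p (k n) / (1 - q)) =O[atTop] fun _ => (1 : ℝ) := by
  simpa only [mul_one, div_eq_mul_inv] using (isTheta_natCast_mul_one hk).1.mul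
    (isBigO_const_const (1 - q)⁻¹ one_ne_zero atTop)

include h hk

theorem GeomRatio.tendsto_natCast_mul_tailSum_sub (j : ℤ) :
    Tendsto (fun n : ℕ => n * tailSum p ((k n + j).toNat) -
      n * p (k n) / (1 - q) * q ^ (j + 1)) atTop (𝓝 0) := by
  have k_tendsto := h.tendsto_atTop_of_isTheta hk
  have toNat_tendsto := tendsto_toNat_add k_tendsto j
  have ratio_tendsto := ((h.tendsto_toNat_add_div k_tendsto j).mul
    (h.tendsto_tailSum_div.comp toNat_tendsto)).sub_const (q ^ j * (q / (1 - q)))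
  rw [sub_self] at ratio_tendsto
  refine (isBoundedUnder_le_mul_tendsto_zero (isTheta_natCast_mul_one hk).1.isBoundedUnder_le
    ratio_tendsto).congr' ?_
  filter_upwards [k_tendsto.eventually h.eventually_pos, toNat_tendsto.eventually h.eventually_pos]
    with n p_pos p_pos'
  have : 1 - q ≠ 0 := (sub_pos.2 h.q_lt_one).ne'
  rw [zpow_add_one₀ h.q_pos.ne', Function.comp_apply]
  field_simp

theorem GeomRatio.tendsto_mul_pow_sub {N : ℕ → ℕ} (hN : (fun n => (N n : ℝ)) ~[atTop]
      (fun n : ℕ => n * p (k n) * (q ^ k n)⁻¹ / (1 - q))) :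
    Tendsto (fun n => N n * q ^ k n - n * p (k n) / (1 - q)) atTop (𝓝 0) := by
  have mul_equivalent : (fun n => N n * q ^ k n) ~[atTop] fun n => n * p (k n) / (1 - q) := by
    refine (hN.mul (IsEquivalent.refl (u := fun n => q ^ k n))).congr_right (.of_forall fun n => ?_)
    have := (pow_pos h.q_pos (k n)).ne'
    simp only [Pi.mul_apply]
    field_simp
  exact (isLittleO_one_iff ℝ).1
    (mul_equivalent.isLittleO.trans_isBigO (isBigO_natCast_mul_div_sub hk))

end

theorem truncPartition_boxProb (w : ℕ → ℝ≥0) (τ : ℝ≥0) (K m n : ℕ) :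
    truncPartition (boxProb w τ) K m n =
      τ ^ m / (genFun w τ).toReal ^ n * truncPartition (fun k => w k) K m n :=
  truncPartition_mul_pow_div _ _ _ _ _ _

section

variable {w : ℕ → ℝ≥0} {τ : ℝ≥0} {lam : ℝ} (h : LatticeLaw (boxProb w τ) lam)
include h

theorem LatticeLaw.pos_and_genFun_toReal_pos : 0 < (τ : ℝ) ∧ 0 < (genFun w τ).toReal := by
  obtain ⟨l, l_pos, succ_pos⟩ := h.exists_pos
  refine ⟨τ.coe_nonneg.lt_of_ne' fun τ_eq => ?_, ENNReal.toReal_nonneg.lt_of_ne' fun Φ_eq => ?_⟩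
  · simp [boxProb, τ_eq] at succ_pos
  · simp [boxProb, Φ_eq] at l_pos

theorem LatticeLaw.truncPartition_div_eq (K m n : ℕ) :
    truncPartition (boxProb w τ) K m n / truncPartition (boxProb w τ) m m n =
      truncPartition (fun k => w k) K m n / partitionFun w m n := by
  obtain ⟨τ_pos, Φ_pos⟩ := h.pos_and_genFun_toReal_pos
  rw [truncPartition_boxProb, truncPartition_boxProb, coe_partitionFun]
  exact mul_div_mul_left _ _ (by positivity)

variable {m : ℕ → ℕ}
  (hm : (fun n : ℕ => (m n : ℝ) - lam * n) =o[atTop] (fun n : ℕ => √(n : ℝ)))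
include hm

theorem LatticeLaw.eventually_partitionFun_pos : ∀ᶠ n in atTop, 0 < partitionFun w (m n) n := by
  obtain ⟨τ_pos, Φ_pos⟩ := h.pos_and_genFun_toReal_pos
  filter_upwards [h.eventually_truncPartition_pos hm] with n hn
  rw [truncPartition_boxProb, ← coe_partitionFun] at hn
  exact NNReal.coe_pos.1 (pos_of_mul_pos_right hn (by positivity))

theorem hasGumbelCDF_maxOccupancy {q : ℝ} (hg : GeomRatio (boxProb w τ) q) {k : ℕ → ℕ}
    (hk : (fun n => boxProb w τ (k n)) =Θ[atTop] (fun n : ℕ => 1 / (n : ℝ))) :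
    HasGumbelCDF q (fun n => n * boxProb w τ (k n) / (1 - q)) (fun n => k n)
      (fun n => (maxOccupancy w (m n) n).toMeasure) := by
  intro j
  have k_tendsto := hg.tendsto_atTop_of_isTheta hk
  have tail_tendsto := hg.tendsto_natCast_mul_tailSum_sub hk j
  have scale_isBigO : (fun n : ℕ => n * boxProb w τ (k n) / (1 - q) * q ^ (j + 1)) =O[atTop]
      fun _ => (1 : ℝ) := by
    simpa only [mul_one] using (isBigO_natCast_mul_div_sub hk).mul
      (isBigO_const_const (q ^ (j + 1)) one_ne_zero atTop)
  have scale_nonneg : ∀ n : ℕ, 0 ≤ n * boxProb w τ (k n) / (1 - q) * q ^ (j + 1) := fun n =>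
    mul_nonneg (div_nonneg (mul_nonneg n.cast_nonneg (h.nonneg _)) (sub_pos.2 hg.q_lt_one).le)
      (zpow_nonneg hg.q_pos.le _)
  have tail_isBigO : (fun n : ℕ => n * tailSum (boxProb w τ) (k n + j).toNat) =O[atTop]
      fun _ => (1 : ℝ) := by
    simpa using (tail_tendsto.isBigO_one ℝ).add scale_isBigO
  have cdf_tendsto := (h.tendsto_truncPartition_div_sub_exp (tendsto_toNat_add k_tendsto j)
    tail_isBigO hm).add (tendsto_exp_neg_sub_exp_neg (.of_forall scale_nonneg) tail_tendsto)
  rw [add_zero] at cdf_tendsto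
  refine cdf_tendsto.congr' ?_
  filter_upwards [h.eventually_partitionFun_pos hm, k_tendsto.eventually_ge_atTop j.natAbs]
    with n Z_pos hn
  rw [h.truncPartition_div_eq, ← maxOccupancy_real_Iic Z_pos.ne',
    Int.toNat_of_nonneg (show 0 ≤ (k n : ℤ) + j by lia), sub_add_sub_cancel]

end

section

variable {q c C : ℝ} {B : ℕ → ℝ} (hq0 : 0 < q) (hq1 : q < 1) (hc : 0 < c)
include hq0 hq1 hc

theorem HasGumbelCDF.dApprox_gumbel {μ : ℕ → Measure ℤ} [∀ n, IsProbabilityMeasure (μ n)]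
    (h : HasGumbelCDF q B 0 μ) (hB : ∀ᶠ n in atTop, B n ∈ Set.Icc c C) :
    DApprox μ (fun n => gumbel.map fun x => ⌊(x + Real.log (B n)) / Real.log (1 / q)⌋) :=
  h.dApprox (hasGumbelCDF_gumbel_log hq0 hq1 (hB.mono fun _ hn => hc.trans_le hn.1)) hq0 hq1 hc hB

theorem HasGumbelCDF.exists_tendsto_gumbel {P : ℕ → ProbabilityMeasure ℤ} {b : ℝ}
    (h : HasGumbelCDF q B 0 fun n => (P n : Measure ℤ))
    (hB : ∀ᶠ n in atTop, B n ∈ Set.Icc c C) (hb : Tendsto B atTop (𝓝 b)) :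
    ∃ L : ProbabilityMeasure ℤ,
      (L : Measure ℤ) = gumbel.map (fun x => ⌊(x + Real.log b) / Real.log (1 / q)⌋) ∧
      Tendsto P atTop (𝓝 L) := by
  have b_pos : 0 < b := hc.trans_le (ge_of_tendsto hb (hB.mono fun _ hn => hn.1))
  have approx := h.dApprox (.of_tendsto hb fun j => gumbel_map_floor_real_Iic hq0 hq1 b_pos j)
    hq0 hq1 hc hB
  exact ⟨⟨_, inferInstance⟩, rfl, tendsto_of_dApprox approx⟩

end

section

variable {p : ℕ → ℝ} {k : ℕ → ℕ} {N : ℕ → ℕ}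

theorem GeomRatio.hasGumbelCDF_maxGeometric {r : unitInterval} (h : GeomRatio p r)
    (hk : (fun n => p (k n)) =Θ[atTop] (fun n : ℕ => 1 / (n : ℝ)))
    (hN : (fun n => (N n : ℝ)) ~[atTop]
      (fun n : ℕ => n * p (k n) * ((r : ℝ) ^ k n)⁻¹ / (1 - r))) :
    HasGumbelCDF r (fun n => n * p (k n) / (1 - r)) (fun n => k n)
      (fun n => maxGeometric (unitInterval.symm r) (N n)) := by
  obtain ⟨c, c_pos, C, bounds⟩ := h.exists_eventually_mem_Icc hk
  have mul_pow_sub := h.tendsto_mul_pow_sub hk hN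
  have mul_pow_isBigO : (fun n => N n * (r : ℝ) ^ k n) =O[atTop] fun _ => (1 : ℝ) := by
    simpa only [sub_add_cancel] using
      (mul_pow_sub.isBigO_one ℝ).add (isBigO_natCast_mul_div_sub (q := r) hk)
  exact (BallsInBoxes.hasGumbelCDF_maxGeometric h.q_pos h.q_lt_one
    (h.tendsto_atTop_of_isTheta hk) mul_pow_isBigO).of_tendsto_sub h.q_pos.le
      (bounds.mono fun _ hn => c_pos.le.trans hn.1) mul_pow_sub

theorem GeomRatio.hasGumbelCDF_gumbel_logb {q : ℝ} (h : GeomRatio p q)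
    (hk : (fun n => p (k n)) =Θ[atTop] (fun n : ℕ => 1 / (n : ℝ)))
    (hN : (fun n => (N n : ℝ)) ~[atTop] (fun n : ℕ => n * p (k n) * (q ^ k n)⁻¹ / (1 - q))) :
    HasGumbelCDF q (fun n => n * p (k n) / (1 - q)) (fun n => k n)
      (fun n => gumbel.map fun x => ⌊x / Real.log (1 / q) + Real.logb (1 / q) (N n)⌋) := by
  obtain ⟨c, c_pos, C, bounds⟩ := h.exists_eventually_mem_Icc hk
  have mul_pow_sub := h.tendsto_mul_pow_sub hk hN
  have N_pos : ∀ᶠ n in atTop, 0 < N n := by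
    filter_upwards [bounds, mul_pow_sub.eventually_const_lt (neg_neg_of_pos c_pos)] with n hn hsub
    refine Nat.pos_of_ne_zero fun N_eq => ?_
    rw [N_eq, Nat.cast_zero, zero_mul, zero_sub, neg_lt_neg_iff] at hsub
    exact hsub.not_ge hn.1
  exact (BallsInBoxes.hasGumbelCDF_gumbel_logb h.q_pos h.q_lt_one N_pos).of_tendsto_sub h.q_pos.le
    (bounds.mono fun _ hn => c_pos.le.trans hn.1) mul_pow_sub

theorem GeomRatio.not_exists_tendsto {q : ℝ} (h : GeomRatio p q)
    (hk : (fun n => p (k n)) =Θ[atTop] (fun n : ℕ => 1 / (n : ℝ)))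
    {P : ℕ → ProbabilityMeasure ℤ}
    (hP : HasGumbelCDF q (fun n => n * p (k n) / (1 - q)) 0 fun n => (P n : Measure ℤ)) :
    ¬ ∃ L, Tendsto P atTop (𝓝 L) := by
  rintro ⟨L, lim⟩
  obtain ⟨c, c_pos, C, bounds⟩ := h.exists_eventually_mem_Icc hk
  obtain ⟨b, hb⟩ := hP.exists_tendsto lim (bounds.mono fun _ hn => hn.2)
  have b_pos : 0 < b := c_pos.trans_le (ge_of_tendsto hb (bounds.mono fun _ hn => hn.1))
  have sub_pos : 0 < 1 - q := sub_pos.2 h.q_lt_one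
  refine h.not_tendsto_natCast_mul_comp (h.tendsto_atTop_of_isTheta hk) (mul_pos b_pos sub_pos) ?_
  simpa only [div_mul_cancel₀ _ sub_pos.ne'] using hb.mul_const (1 - q)

end

/-! ### Power series of the weights -/

namespace GeomRatio

variable {p : ℕ → ℝ} {q : ℝ}

theorem natCast_pow_mul (h : GeomRatio p q) (r : ℕ) : GeomRatio (fun k => (k : ℝ) ^ r * p k) q where
  nonneg k := mul_nonneg (by positivity) (h.nonneg k)
  q_pos := h.q_pos
  q_lt_one := h.q_lt_one
  ratio := by
    have pow_ratio : Tendsto (fun k : ℕ => ((k + 1 : ℕ) / (k : ℝ)) ^ r) atTop (𝓝 1) := by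
      simpa using ((tendsto_natCast_div_add_atTop (1 : ℝ)).inv₀ one_ne_zero).pow r
    simpa only [one_mul, mul_div_mul_comm, div_pow] using pow_ratio.mul h.ratio

theorem div_const (h : GeomRatio p q) {s : ℝ} (hs : 0 < s) : GeomRatio (fun k => p k / s) q where
  nonneg k := div_nonneg (h.nonneg k) hs.le
  q_pos := h.q_pos
  q_lt_one := h.q_lt_one
  ratio := by simpa only [div_div_div_cancel_right₀ hs.ne'] using h.ratio

end GeomRatio

/-- The series `∑ k ^ r w_k t ^ k`, that is, `(t d/dt)^r Φ(t)`, for real `t`. The value is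
meaningful only where the series converges. -/
noncomputable def genMoment (w : ℕ → ℝ≥0) (r : ℕ) (t : ℝ) : ℝ :=
  ∑' k : ℕ, (k : ℝ) ^ r * (w k * t ^ k)

/-- The function `Ψ` for real arguments inside the interval of convergence: the mean of the
distribution with probabilities proportional to `w_k t ^ k`. -/
noncomputable def tiltedMean (w : ℕ → ℝ≥0) (t : ℝ) : ℝ := genMoment w 1 t / genMoment w 0 t

section

variable {w : ℕ → ℝ≥0}

theorem genMoment_nonneg (r : ℕ) {t : ℝ} (ht : 0 ≤ t) : 0 ≤ genMoment w r t :=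
  tsum_nonneg fun _ => by positivity

theorem tiltedMean_nonneg {t : ℝ} (ht : 0 ≤ t) : 0 ≤ tiltedMean w t :=
  div_nonneg (genMoment_nonneg 1 ht) (genMoment_nonneg 0 ht)

theorem tiltedMean_zero : tiltedMean w 0 = 0 := by
  have term_eq : ∀ k : ℕ, (k : ℝ) ^ 1 * (w k * 0 ^ k) = 0 := fun k => by cases k <;> simp
  simp only [tiltedMean, genMoment, term_eq, tsum_zero, zero_div]

theorem rpow_mul_sub_le_rpow_mul_sub {x : ℝ} (hx : 1 ≤ x) (k l : ℝ) :
    x ^ l * (k - l) ≤ x ^ k * (k - l) := by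
  rcases le_total l k with hlk | hkl
  · exact mul_le_mul_of_nonneg_right (Real.rpow_le_rpow_of_exponent_le hx hlk) (sub_nonneg.2 hlk)
  · exact mul_le_mul_of_nonpos_right (Real.rpow_le_rpow_of_exponent_le hx hkl) (sub_nonpos.2 hkl)

theorem genFun_pos (hw0 : 0 < w 0) (t : ℝ≥0∞) : 0 < genFun w t :=
  (ENNReal.coe_pos.2 hw0).trans_le <| by
    simpa [genFun] using ENNReal.le_tsum (f := fun k => (w k : ℝ≥0∞) * t ^ k) 0

theorem tsum_natCast_pow_mul_coe {t : ℝ≥0} {r : ℕ}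
    (hs : Summable fun k : ℕ => (k : ℝ) ^ r * (w k * (t : ℝ) ^ k)) :
    ∑' k : ℕ, (k : ℝ≥0∞) ^ r * (w k * (t : ℝ≥0∞) ^ k) = ENNReal.ofReal (genMoment w r t) := by
  rw [genMoment, ENNReal.ofReal_tsum_of_nonneg (fun k => by positivity) hs]
  exact tsum_congr fun k => mod_cast (ENNReal.ofReal_coe_nnreal (p := k ^ r * (w k * t ^ k))).symm

theorem genFun_coe {t : ℝ≥0} (hs : Summable fun k : ℕ => (k : ℝ) ^ 0 * (w k * (t : ℝ) ^ k)) :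
    genFun w t = ENNReal.ofReal (genMoment w 0 t) := by
  simpa only [genFun, pow_zero, one_mul] using tsum_natCast_pow_mul_coe hs

theorem psiQuot_coe {t : ℝ≥0} (h0 : Summable fun k : ℕ => (k : ℝ) ^ 0 * (w k * (t : ℝ) ^ k))
    (h1 : Summable fun k : ℕ => (k : ℝ) ^ 1 * (w k * (t : ℝ) ^ k)) (hpos : 0 < genMoment w 0 t) :
    psiQuot w t = ENNReal.ofReal (tiltedMean w t) := by
  rw [psiQuot, genFun_coe h0, tiltedMean, ENNReal.ofReal_div_of_pos hpos,
    ← tsum_natCast_pow_mul_coe h1]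
  simp only [pow_one]

/- The numerator is a supremum of continuous partial sums, hence lower semicontinuous, and the
denominator is largest at `u`. -/
theorem exists_lt_psiQuot_of_genFun_lt_top (hw0 : 0 < w 0) {u x : ℝ≥0∞} (hu : 0 < u)
    (hfin : genFun w u < ∞) (hx : x < psiQuot w u) : ∃ t < u, x < psiQuot w t := by
  have : (𝓝[<] u).NeBot := nhdsLT_neBot_of_exists_lt ⟨0, hu⟩
  rw [psiQuot, ENNReal.lt_div_iff_mul_lt (.inl (genFun_pos hw0 u).ne') (.inl hfin.ne),
    ENNReal.tsum_eq_iSup_sum, lt_iSup_iff] at hx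
  obtain ⟨F, hF⟩ := hx
  have partialSum_continuous :
      Continuous fun t : ℝ≥0∞ => ∑ k ∈ F, (k : ℝ≥0∞) * ((w k : ℝ≥0∞) * t ^ k) :=
    continuous_finsetSum _ fun k _ => (ENNReal.continuous_const_mul (ENNReal.natCast_ne_top k)).comp
      ((ENNReal.continuous_const_mul ENNReal.coe_ne_top).comp (ENNReal.continuous_pow k))
  obtain ⟨t, lt_partialSum, t_lt⟩ := ((((partialSum_continuous.tendsto u).mono_left
    (nhdsWithin_le_nhds (s := Set.Iio u))).eventually_const_lt hF).and
      eventually_mem_nhdsWithin).exists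
  rw [Set.mem_Iio] at t_lt
  have genFun_le : genFun w t ≤ genFun w u := ENNReal.tsum_le_tsum fun k => by gcongr
  refine ⟨t, t_lt, ?_⟩
  rw [psiQuot, ENNReal.lt_div_iff_mul_lt (.inl (genFun_pos hw0 t).ne')
    (.inl (genFun_le.trans_lt hfin).ne)]
  calc x * genFun w t ≤ x * genFun w u := by gcongr
    _ < ∑ k ∈ F, (k : ℝ≥0∞) * ((w k : ℝ≥0∞) * t ^ k) := lt_partialSum
    _ ≤ ∑' k : ℕ, (k : ℝ≥0∞) * ((w k : ℝ≥0∞) * t ^ k) := ENNReal.sum_le_tsum F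

theorem exists_lt_of_lt_limUnder_nhdsLT {f : ℝ≥0∞ → ℝ≥0∞} {u x : ℝ≥0∞} (hu : 0 < u)
    (hf : MonotoneOn f (Set.Iio u)) (hx : x < limUnder (𝓝[<] u) f) : ∃ t < u, x < f t := by
  have : (𝓝[<] u).NeBot := nhdsLT_neBot_of_exists_lt ⟨0, hu⟩
  rw [(hf.tendsto_nhdsLT (OrderTop.bddAbove _)).limUnder_eq] at hx
  obtain ⟨_, ⟨t, t_lt, rfl⟩, lt_f⟩ := lt_sSup_iff.1 hx
  exact ⟨t, t_lt, lt_f⟩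

end

section

variable {w : ℕ → ℝ≥0} {a : ℝ} (ha : 0 < a)
  (hw : Tendsto (fun k => (w (k + 1) : ℝ) / (w k : ℝ)) atTop (𝓝 a))
include ha hw

theorem geomRatio_mul_pow {t : ℝ} (ht : 0 < t) (hta : t < a⁻¹) :
    GeomRatio (fun k => w k * t ^ k) (t * a) where
  nonneg k := by positivity
  q_pos := by positivity
  q_lt_one := by rwa [← lt_div_iff₀ ha, one_div]
  ratio := by
    rw [mul_comm]
    refine (hw.mul_const t).congr fun k => ?_
    rw [mul_div_mul_comm, pow_succ, mul_div_cancel_left₀ _ (pow_pos ht k).ne']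

theorem summable_pow_mul_mul_pow {t : ℝ} (ht : 0 ≤ t) (hta : t < a⁻¹) (r : ℕ) :
    Summable fun k : ℕ => (k : ℝ) ^ r * (w k * t ^ k) := by
  rcases ht.eq_or_lt with rfl | ht
  · refine summable_of_ne_finset_zero (s := {0}) fun k hk => ?_
    rw [zero_pow (Finset.notMem_singleton.1 hk), mul_zero, mul_zero]
  · exact ((geomRatio_mul_pow ha hw ht hta).natCast_pow_mul r).summable

theorem rho_eq_ofReal_inv : rho w = ENNReal.ofReal a⁻¹ := by
  have radius_eq := FormalMultilinearSeries.ofScalars_radius_eq_inv_of_tendsto ℝ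
    (fun k => (w k : ℝ)) (Real.toNNReal_pos.2 ha).ne'
    (by simpa only [Real.coe_toNNReal a ha.le, NNReal.norm_eq] using hw)
  rw [rho, radius_eq, ← Real.toNNReal_inv]
  rfl

theorem coe_lt_rho_iff {t : ℝ≥0} : (t : ℝ≥0∞) < rho w ↔ (t : ℝ) < a⁻¹ := by
  rw [rho_eq_ofReal_inv ha hw, ← ENNReal.ofReal_coe_nnreal,
    ENNReal.ofReal_lt_ofReal_iff (inv_pos.2 ha)]

theorem coe_div_rho (t : ℝ≥0) : (t : ℝ≥0∞) / rho w = ENNReal.ofReal (t * a) := by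
  rw [rho_eq_ofReal_inv ha hw, ← ENNReal.ofReal_coe_nnreal,
    ← ENNReal.ofReal_div_of_pos (inv_pos.2 ha), div_inv_eq_mul]

theorem continuousOn_genMoment {b : ℝ} (hb : 0 ≤ b) (hba : b < a⁻¹) (r : ℕ) :
    ContinuousOn (genMoment w r) (Set.Icc 0 b) := by
  refine continuousOn_tsum (fun k => by fun_prop) (summable_pow_mul_mul_pow ha hw hb hba r)
    fun k t ⟨t_nonneg, t_le⟩ => ?_
  rw [Real.norm_of_nonneg (by positivity)]
  gcongr

theorem boxProb_eq_div_genMoment {τ : ℝ≥0} (hτa : (τ : ℝ) < a⁻¹) :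
    boxProb w τ = fun k => w k * (τ : ℝ) ^ k / genMoment w 0 τ := by
  ext k
  rw [boxProb, genFun_coe (summable_pow_mul_mul_pow ha hw τ.coe_nonneg hτa 0),
    ENNReal.toReal_ofReal (genMoment_nonneg 0 τ.coe_nonneg)]

variable (hw0 : 0 < w 0)
include hw0

theorem genMoment_zero_pos {t : ℝ} (ht : 0 ≤ t) (hta : t < a⁻¹) : 0 < genMoment w 0 t :=
  (summable_pow_mul_mul_pow ha hw ht hta 0).tsum_pos (fun k => by positivity) 0 (by simpa using hw0)

theorem tiltedMean_pos {t : ℝ} (ht : 0 < t) (hta : t < a⁻¹) : 0 < tiltedMean w t := by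
  obtain ⟨k, term_pos, k_pos⟩ :=
    ((geomRatio_mul_pow ha hw ht hta).eventually_pos.and (eventually_gt_atTop 0)).exists
  have : (0 : ℝ) < k := Nat.cast_pos.2 k_pos
  exact div_pos ((summable_pow_mul_mul_pow ha hw ht.le hta 1).tsum_pos (fun k => by positivity) k
    (by positivity)) (genMoment_zero_pos ha hw hw0 ht.le hta)

theorem hasSum_mul_sub_tiltedMean {t : ℝ} (ht : 0 ≤ t) (hta : t < a⁻¹) (l : ℝ) :
    HasSum (fun k : ℕ => w k * t ^ k * (k - l)) (genMoment w 0 t * (tiltedMean w t - l)) := by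
  have hasSum_sub := (summable_pow_mul_mul_pow ha hw ht hta 1).hasSum.sub
    ((summable_pow_mul_mul_pow ha hw ht hta 0).hasSum.mul_right l)
  convert! hasSum_sub using 1
  · ext k
    ring
  · rw [tiltedMean, mul_sub, mul_div_cancel₀ _ (genMoment_zero_pos ha hw hw0 ht hta).ne']
    rfl

/- The law at `t` is the law at `s` tilted by the increasing factor `(t / s) ^ k`; comparing this
factor with its value at the mean `l` of the law at `s` shows that tilting raises the mean. -/
theorem strictMonoOn_tiltedMean : StrictMonoOn (tiltedMean w) (Set.Ico 0 a⁻¹) := by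
  intro s ⟨s_nonneg, hsa⟩ t ⟨t_nonneg, hta⟩ hst
  rcases s_nonneg.eq_or_lt with rfl | s_pos
  · rw [tiltedMean_zero]
    exact tiltedMean_pos ha hw hw0 hst hta
  set l := tiltedMean w s with l_def
  have l_pos : 0 < l := tiltedMean_pos ha hw hw0 s_pos hsa
  have one_lt : 1 < t / s := (one_lt_div s_pos).2 hst
  have sum_s := (hasSum_mul_sub_tiltedMean ha hw hw0 s_nonneg hsa l).mul_left ((t / s) ^ l)
  rw [← l_def, sub_self, mul_zero, mul_zero] at sum_s
  have pow_eq : ∀ k : ℕ, t ^ k = s ^ k * (t / s) ^ (k : ℝ) := fun k => by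
    rw [Real.rpow_natCast, div_pow, mul_div_cancel₀ _ (pow_pos s_pos k).ne']
  have term_le : ∀ k : ℕ, (t / s) ^ l * (w k * s ^ k * (k - l)) ≤ w k * t ^ k * (k - l) :=
    fun k => by
      calc (t / s) ^ l * (w k * s ^ k * (k - l)) = w k * s ^ k * ((t / s) ^ l * (k - l)) := by ring
        _ ≤ w k * s ^ k * ((t / s) ^ (k : ℝ) * (k - l)) :=
          mul_le_mul_of_nonneg_left (rpow_mul_sub_le_rpow_mul_sub one_lt.le k l) (by positivity)
        _ = w k * t ^ k * (k - l) := by rw [pow_eq]; ring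
  have term_zero_lt : (t / s) ^ l * (w 0 * s ^ 0 * ((0 : ℕ) - l)) <
      w 0 * t ^ 0 * ((0 : ℕ) - l) := by
    have : 0 < (w 0 : ℝ) * l := by positivity
    have := mul_lt_mul_of_pos_right (Real.one_lt_rpow one_lt l_pos) this
    simp only [pow_zero, mul_one, Nat.cast_zero, zero_sub, mul_neg, one_mul] at this ⊢
    linarith
  have sum_pos := hasSum_lt term_le term_zero_lt sum_s
    (hasSum_mul_sub_tiltedMean ha hw hw0 t_nonneg hta l)
  exact sub_pos.1 (pos_of_mul_pos_right sum_pos (genMoment_nonneg 0 t_nonneg))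

theorem psiQuot_coe_of_lt {t : ℝ≥0} (hta : (t : ℝ) < a⁻¹) :
    psiQuot w t = ENNReal.ofReal (tiltedMean w t) :=
  psiQuot_coe (summable_pow_mul_mul_pow ha hw t.coe_nonneg hta 0)
    (summable_pow_mul_mul_pow ha hw t.coe_nonneg hta 1)
    (genMoment_zero_pos ha hw hw0 t.coe_nonneg hta)

theorem psi_coe_of_lt {t : ℝ≥0} (hta : (t : ℝ) < a⁻¹) :
    psi w t = ENNReal.ofReal (tiltedMean w t) := by
  rw [psi, if_pos, psiQuot_coe_of_lt ha hw hw0 hta]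
  rw [genFun_coe (summable_pow_mul_mul_pow ha hw t.coe_nonneg hta 0)]
  exact ENNReal.ofReal_lt_top

theorem monotoneOn_psiQuot : MonotoneOn (psiQuot w) (Set.Iio (rho w)) := by
  intro s hs t ht hst
  obtain ⟨s, rfl, s_lt⟩ := ENNReal.lt_iff_exists_coe.1 (Set.mem_Iio.1 hs)
  obtain ⟨t, rfl, t_lt⟩ := ENNReal.lt_iff_exists_coe.1 (Set.mem_Iio.1 ht)
  rw [coe_lt_rho_iff ha hw] at s_lt t_lt
  rw [psiQuot_coe_of_lt ha hw hw0 s_lt, psiQuot_coe_of_lt ha hw hw0 t_lt]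
  exact ENNReal.ofReal_le_ofReal
    ((strictMonoOn_tiltedMean ha hw hw0).monotoneOn ⟨s.coe_nonneg, s_lt⟩ ⟨t.coe_nonneg, t_lt⟩
      (ENNReal.coe_le_coe.1 hst))

theorem exists_lt_psiQuot_of_lt_nu {x : ℝ≥0∞} (hx : x < nu w) : ∃ t < rho w, x < psiQuot w t := by
  have rho_pos : 0 < rho w := by
    rw [rho_eq_ofReal_inv ha hw]
    exact ENNReal.ofReal_pos.2 (inv_pos.2 ha)
  rw [nu, psi] at hx
  split_ifs at hx with hfin
  · exact exists_lt_psiQuot_of_genFun_lt_top hw0 rho_pos hfin hx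
  · exact exists_lt_of_lt_limUnder_nhdsLT rho_pos (monotoneOn_psiQuot ha hw hw0) hx

theorem exists_tiltedMean_eq {lam : ℝ} (hlam : 0 < lam) (hnu : ENNReal.ofReal lam < nu w) :
    ∃ τ : ℝ≥0, 0 < (τ : ℝ) ∧ (τ : ℝ) < a⁻¹ ∧ tiltedMean w τ = lam := by
  obtain ⟨_, b_lt, lt_psiQuot⟩ := exists_lt_psiQuot_of_lt_nu ha hw hw0 hnu
  obtain ⟨b, rfl, -⟩ := ENNReal.lt_iff_exists_coe.1 b_lt
  rw [coe_lt_rho_iff ha hw] at b_lt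
  rw [psiQuot_coe_of_lt ha hw hw0 b_lt, ENNReal.ofReal_lt_ofReal_iff_of_nonneg hlam.le]
    at lt_psiQuot
  have continuousOn_tiltedMean : ContinuousOn (tiltedMean w) (Set.Icc 0 b) :=
    (continuousOn_genMoment ha hw b.coe_nonneg b_lt 1).div
      (continuousOn_genMoment ha hw b.coe_nonneg b_lt 0)
      fun t ht => (genMoment_zero_pos ha hw hw0 ht.1 (ht.2.trans_lt b_lt)).ne'
  obtain ⟨t, ⟨t_nonneg, t_le⟩, ht⟩ := intermediate_value_Icc b.coe_nonneg continuousOn_tiltedMean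
    ⟨tiltedMean_zero.trans_le hlam.le, lt_psiQuot.le⟩
  refine ⟨⟨t, t_nonneg⟩, t_nonneg.lt_of_ne' fun t_eq => hlam.ne ?_, t_le.trans_lt b_lt, ht⟩
  rw [← ht, show t = 0 from t_eq, tiltedMean_zero]

theorem eq_of_psi_eq {τ : ℝ≥0} (hτa : (τ : ℝ) < a⁻¹)
    (hnu : ENNReal.ofReal (tiltedMean w τ) < nu w) {t : ℝ≥0∞} (ht : t ≤ rho w)
    (hpsi : psi w t = ENNReal.ofReal (tiltedMean w τ)) : t = τ := by
  rcases ht.eq_or_lt with rfl | t_lt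
  · exact absurd hpsi hnu.ne'
  obtain ⟨t, rfl, -⟩ := ENNReal.lt_iff_exists_coe.1 t_lt
  rw [coe_lt_rho_iff ha hw] at t_lt
  rw [psi_coe_of_lt ha hw hw0 t_lt, ENNReal.ofReal_eq_ofReal_iff (tiltedMean_nonneg t.coe_nonneg)
    (tiltedMean_nonneg τ.coe_nonneg)] at hpsi
  exact congrArg _ (NNReal.coe_injective ((strictMonoOn_tiltedMean ha hw hw0).injOn
    ⟨t.coe_nonneg, t_lt⟩ ⟨τ.coe_nonneg, hτa⟩ hpsi))

theorem geomRatio_boxProb {τ : ℝ≥0} (hτ : 0 < (τ : ℝ)) (hτa : (τ : ℝ) < a⁻¹) :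
    GeomRatio (boxProb w τ) (τ * a) := by
  rw [boxProb_eq_div_genMoment ha hw hτa]
  exact (geomRatio_mul_pow ha hw hτ hτa).div_const (genMoment_zero_pos ha hw hw0 hτ.le hτa)

theorem latticeLaw_boxProb {τ : ℝ≥0} (hτ : 0 < (τ : ℝ)) (hτa : (τ : ℝ) < a⁻¹) :
    LatticeLaw (boxProb w τ) (tiltedMean w τ) where
  nonneg := (geomRatio_boxProb ha hw hw0 hτ hτa).nonneg
  hasSum := by
    have := (summable_pow_mul_mul_pow ha hw hτ.le hτa 0).hasSum.div_const (genMoment w 0 τ)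
    rw [← genMoment, div_self (genMoment_zero_pos ha hw hw0 hτ.le hτa).ne'] at this
    simpa only [boxProb_eq_div_genMoment ha hw hτa, pow_zero, one_mul] using this
  hasSum_mean := by
    have := (summable_pow_mul_mul_pow ha hw hτ.le hτa 1).hasSum.div_const (genMoment w 0 τ)
    rw [← genMoment, ← tiltedMean] at this
    simpa only [boxProb_eq_div_genMoment ha hw hτa, pow_one, mul_div_assoc] using this
  summable_sq := ((geomRatio_boxProb ha hw hw0 hτ hτa).natCast_pow_mul 2).summable
  exists_pos :=
    have eventually_pos := (geomRatio_boxProb ha hw hw0 hτ hτa).eventually_pos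
    (eventually_pos.and ((tendsto_add_atTop_nat 1).eventually eventually_pos)).exists

end

theorem mul_boxProb_mul_inv_pow_div (w : ℕ → ℝ≥0) {τ : ℝ≥0} (hτ : 0 < (τ : ℝ)) (a x : ℝ) (k : ℕ) :
    x * boxProb w τ k * ((τ * a) ^ k)⁻¹ / (1 - τ * a) =
      x * w k * (a ^ k)⁻¹ / ((genFun w τ).toReal * (1 - τ * a)) := by
  rw [boxProb, mul_pow, mul_inv]
  field_simp

end BallsInBoxes

theorem mainTheorem11 (w : ℕ → ℝ≥0) (a lam : ℝ) (m : ℕ → ℕ)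
    (hw0 : 0 < w 0)
    (ha : 0 < a)
    (hw : Tendsto (fun k => (w (k + 1) : ℝ) / (w k : ℝ)) atTop (𝓝 a))
    (hlam : 0 < lam)
    (hnu : ENNReal.ofReal lam < BallsInBoxes.nu w)
    (hm : (fun n : ℕ => (m n : ℝ) - lam * n) =o[atTop] (fun n : ℕ => √(n : ℝ))) :
    -- the random allocation exists for all large `n`
    (∀ᶠ n in atTop, 0 < BallsInBoxes.partitionFun w (m n) n) ∧
    -- `τ` is the unique solution in `[0, ρ]` of `Ψ(τ) = λ`, and `q = τ a = τ / ρ < 1`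
    ∃ (τ : ℝ≥0) (q : unitInterval),
      ((τ : ℝ≥0∞) ≤ BallsInBoxes.rho w ∧
        BallsInBoxes.psi w τ = ENNReal.ofReal lam ∧
        ∀ t : ℝ≥0∞, t ≤ BallsInBoxes.rho w →
          BallsInBoxes.psi w t = ENNReal.ofReal lam → t = τ) ∧
      ((q : ℝ) = τ * a ∧ ENNReal.ofReal (q : ℝ) = τ / BallsInBoxes.rho w ∧
        0 < (q : ℝ) ∧ (q : ℝ) < 1) ∧
      -- `π_{k(n)} = Θ(1/n)` if and only if `k(n) = k₁(n) + O(1)`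
      (∀ k : ℕ → ℕ,
        (fun n => BallsInBoxes.boxProb w τ (k n)) =Θ[atTop] (fun n : ℕ => 1 / (n : ℝ)) ↔
        (fun n => (k n : ℝ) - (BallsInBoxes.kOne w τ n : ℝ)) =O[atTop] (fun _ => (1 : ℝ))) ∧
      ∀ k : ℕ → ℕ,
        (fun n => BallsInBoxes.boxProb w τ (k n)) =Θ[atTop] (fun n : ℕ => 1 / (n : ℝ)) →
        -- the two expressions for the asymptotic size of `N` agree
        (∀ n : ℕ, (n : ℝ) * BallsInBoxes.boxProb w τ (k n) * ((q : ℝ) ^ k n)⁻¹ / (1 - q) =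
          (n : ℝ) * w (k n) * (a ^ k n)⁻¹ / ((BallsInBoxes.genFun w τ).toReal * (1 - q))) ∧
        (∀ N : ℕ → ℕ,
          (fun n => (N n : ℝ)) ~[atTop]
            (fun n : ℕ =>
              (n : ℝ) * BallsInBoxes.boxProb w τ (k n) * ((q : ℝ) ^ k n)⁻¹ / (1 - q)) →
          -- (i)
          BallsInBoxes.DApprox (fun n => (BallsInBoxes.maxOccupancy w (m n) n).toMeasure)
            (fun n => BallsInBoxes.maxGeometric (unitInterval.symm q) (N n)) ∧
          -- (ii)
          BallsInBoxes.DApprox (fun n => (BallsInBoxes.maxOccupancy w (m n) n).toMeasure)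
            (fun n => BallsInBoxes.gumbel.map
              (fun x => ⌊x / Real.log (1 / (q : ℝ)) + Real.logb (1 / (q : ℝ)) (N n)⌋))) ∧
        -- (iii)
        (fun n : ℕ => (n : ℝ) * BallsInBoxes.boxProb w τ (k n)) =Θ[atTop] (fun _ => (1 : ℝ)) ∧
        BallsInBoxes.DApprox
          (fun n => ((BallsInBoxes.maxOccupancy w (m n) n).map (fun y => y - (k n : ℤ))).toMeasure)
          (fun n => BallsInBoxes.gumbel.map
            (fun x => ⌊(x + Real.log ((n : ℝ) * BallsInBoxes.boxProb w τ (k n) / (1 - q))) /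
              Real.log (1 / (q : ℝ))⌋)) ∧
        IsTightMeasureSet (Set.range fun n =>
          ((BallsInBoxes.maxOccupancy w (m n) n).map (fun y => y - (k n : ℤ))).toMeasure) ∧
        -- convergence in distribution along every subsequence along which `b_n` converges
        (∀ (φ : ℕ → ℕ) (b : ℝ), StrictMono φ →
          Tendsto (fun j => (φ j : ℝ) * BallsInBoxes.boxProb w τ (k (φ j))) atTop (𝓝 b) →
          ∃ L : ProbabilityMeasure ℤ,
            (L : Measure ℤ) = BallsInBoxes.gumbel.map
              (fun x => ⌊(x + Real.log (b / (1 - q))) / Real.log (1 / (q : ℝ))⌋) ∧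
            Tendsto (fun j => BallsInBoxes.toProb
              ((BallsInBoxes.maxOccupancy w (m (φ j)) (φ j)).map
                (fun y => y - (k (φ j) : ℤ)))) atTop (𝓝 L)) ∧
        -- there is no limit distribution
        ¬ ∃ L : ProbabilityMeasure ℤ,
          Tendsto (fun n => BallsInBoxes.toProb
            ((BallsInBoxes.maxOccupancy w (m n) n).map (fun y => y - (k n : ℤ)))) atTop (𝓝 L) := by
  obtain ⟨τ, τ_pos, τ_lt, rfl⟩ := BallsInBoxes.exists_tiltedMean_eq ha hw hw0 hlam hnu
  have law := BallsInBoxes.latticeLaw_boxProb ha hw hw0 τ_pos τ_lt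
  have geom := BallsInBoxes.geomRatio_boxProb ha hw hw0 τ_pos τ_lt
  refine ⟨law.eventually_partitionFun_pos hm, τ, ⟨τ * a, geom.q_pos.le, geom.q_lt_one.le⟩,
    ⟨((BallsInBoxes.coe_lt_rho_iff ha hw).2 τ_lt).le,
      BallsInBoxes.psi_coe_of_lt ha hw hw0 τ_lt,
      fun t => BallsInBoxes.eq_of_psi_eq ha hw hw0 τ_lt hnu⟩,
    ⟨rfl, (BallsInBoxes.coe_div_rho ha hw τ).symm, geom.q_pos, geom.q_lt_one⟩,
    geom.isTheta_iff_sub_sSup_isBigO, fun k hk => ?_⟩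
  obtain ⟨c, c_pos, C, bounds⟩ := geom.exists_eventually_mem_Icc hk
  have hY := BallsInBoxes.hasGumbelCDF_maxOccupancy law hm geom hk
  have hY_sub := hY.map_sub
  refine ⟨fun n => BallsInBoxes.mul_boxProb_mul_inv_pow_div w τ_pos a n (k n),
    fun N hN => ⟨?_, ?_⟩, BallsInBoxes.isTheta_natCast_mul_one hk,
    hY_sub.dApprox_gumbel geom.q_pos geom.q_lt_one c_pos bounds,
    hY_sub.isTightMeasureSet geom.q_pos geom.q_lt_one c_pos bounds, fun φ b hφ hb => ?_,
    geom.not_exists_tendsto hk hY_sub⟩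
  · exact hY.dApprox (geom.hasGumbelCDF_maxGeometric (r := ⟨τ * a, _⟩) hk hN) geom.q_pos
      geom.q_lt_one c_pos bounds
  · exact hY.dApprox (geom.hasGumbelCDF_gumbel_logb hk hN) geom.q_pos geom.q_lt_one c_pos bounds
  · exact BallsInBoxes.HasGumbelCDF.exists_tendsto_gumbel geom.q_pos geom.q_lt_one c_pos
      (P := fun j => BallsInBoxes.toProb _) (hY_sub.comp hφ.tendsto_atTop)
      (hφ.tendsto_atTop.eventually bounds) (hb.div_const _)
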